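/- **Notation.** Let $\mathbb H$ be the real quaternions. For $M\in\mathbb H^{p\times p}$ and $i\in\{1,\dots,p\}$, the $i$-th row determinant is $$\operatorname{rdet}_i M=\sum_{\sigma\in S_p}(-1)^{p-c}\,\bigl(m_{i\,\sigma(i)}m_{\sigma(i)\,\sigma^2(i)}\cdots m_{\sigma^{\ell_1}(i)\,i}\bigr)\bigl(m_{u_2\,\sigma(u_2)}\cdots m_{\sigma^{\ell_2}(u_2)\,u_2}\bigr)\cdots\bigl(m_{u_c\,\sigma(u_c)}\cdots m_{\sigma^{\ell_c}(u_c)\,u_c}\bigr),$$ where $c$ is the number of cycles of $\sigma$ (fixed points included), $\ell_1+1,\dots,\ell_c+1$ are their lengths, the first cycle is the one containing $i$, and $u_2<\dots<u_c$ are the least elements of the other cycles. The $i$-th column determinant is $$\operatorname{cdet}_i M=\sum_{\tau\in S_p}(-1)^{p-c}\,\bigl(m_{u_c\,\tau^{\ell_c}(u_c)}\cdots m_{\tau(u_c)\,u_c}\bigr)\cdots\bigl(m_{u_2\,\tau^{\ell_2}(u_2)}\cdots m_{\tau(u_2)\,u_2}\bigr)\bigl(m_{i\,\tau^{\ell_1}(i)}\cdots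 m_{\tau^2(i)\,\tau(i)}m_{\tau(i)\,i}\bigr),$$ with the same conventions for $\tau$. For a Hermitian matrix all row and column determinants coincide and are real; their common value is its determinant $|\cdot|$, and the determinant of the empty matrix is $1$. $M_{.i}(b)$ (resp. $M_{i.}(b)$) is $M$ with its $i$-th column (resp. row) replaced by $b$, and $M_\beta^\beta$ is the principal submatrix with rows and columns indexed by $\beta$; the row and column determinants of $M_\beta^\beta$ are labelled by the elements of $\beta$. Let $L_{r,p}$ be the set of $r$-element subsets of $\{1,\dots,p\}$ and $L_{r,p}\{i\}$ the set of those containing $i$. The rank of a quaternion matrix is the dimension of the right $\mathbb H$-span of its columns. The index of $M$ is the least $k\ge 0$ with $\operatorname{rank}M^{k+1}=\operatorname{rank}M^k$, and the Drazin inverse $M^D$ is the unique matrix $Y$ with $M^{k+1}Y=M^k$, $YMY=Y$ and $MY=YM$. **Theorem.** Let $A\in\mathbb H^{n\times n}$ and $B\in\mathbb H^{m\times m}$ be Hermitian, of indices $k_1$ and $k_2$, with $\operatorname{rank}A^{k_1+1}=\operatorname{rank}A^{k_1}=r_1$ and $\operatorname{rank}B^{k_2+1}=\operatorname{rank}B^{k_2}=r_2$.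 Let $D\in\mathbb H^{n\times m}$, $\widetilde D=A^{k_1}DB^{k_2}$, with rows $\tilde d_{l.}$ and columns $\tilde d_{.t}$, and let $X=(x_{ij})=A^DDB^D$ be the Drazin inverse solution of $AXB=D$. Put $$d^B_{lj}=\sum_{\alpha\in L_{r_2,m}\{j\}}\operatorname{rdet}_j\Bigl(\bigl(B^{k_2+1}\bigr)_{j.}(\tilde d_{l.})\Bigr)_\alpha^\alpha,\qquad d^A_{it}=\sum_{\beta\in L_{r_1,n}\{i\}}\operatorname{cdet}_i\Bigl(\bigl(A^{k_1+1}\bigr)_{.i}(\tilde d_{.t})\Bigr)_\beta^\beta,$$ and let $d^B_{.j}=(d^B_{lj})_{l=1}^n$ (a column) and $d^A_{i.}=(d^A_{it})_{t=1}^m$ (a row). Then the sums $\sum_{\beta\in L_{r_1,n}}\bigl|(A^{k_1+1})_\beta^\beta\bigr|$ and $\sum_{\alpha\in L_{r_2,m}}\bigl|(B^{k_2+1})_\alpha^\alpha\bigr|$ are nonzero real numbers, and for all $1\le i\le n$, $1\le j\le m$, $$x_{ij}=\frac{\displaystyle\sum_{\beta\in L_{r_1,n}\{i\}}\operatorname{cdet}_i\Bigl(\bigl(A^{k_1+1}\bigr)_{.i}(d^B_{.j})\Bigr)_\beta^\beta}{\displaystyle\sum_{\beta\in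 L_{r_1,n}}\bigl|(A^{k_1+1})_\beta^\beta\bigr|\ \sum_{\alpha\in L_{r_2,m}}\bigl|(B^{k_2+1})_\alpha^\alpha\bigr|}$$ and $$x_{ij}=\frac{\displaystyle\sum_{\alpha\in L_{r_2,m}\{j\}}\operatorname{rdet}_j\Bigl(\bigl(B^{k_2+1}\bigr)_{j.}(d^A_{i.})\Bigr)_\alpha^\alpha}{\displaystyle\sum_{\beta\in L_{r_1,n}}\bigl|(A^{k_1+1})_\beta^\beta\bigr|\ \sum_{\alpha\in L_{r_2,m}}\bigl|(B^{k_2+1})_\alpha^\alpha\bigr|}.$$ -/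

import Mathlib

open scoped Quaternion

namespace QuatDrazin

/-! ## Row and column determinants -/

section Determinants

variable {ι : Type*} [Fintype ι] [LinearOrder ι]

/-- The first elements of the cycles of `σ` (fixed points are cycles of length one): the cycle
containing `i` comes first and is opened by `i`; every other cycle is opened by its least element,
and these cycles are listed by increasing first elements. -/
def leaders (σ : Equiv.Perm ι) (i : ι) : List ι :=
  i :: (Finset.univ.filter
    fun a => ¬ σ.SameCycle i a ∧ ∀ b, σ.SameCycle a b → a ≤ b).sort (· ≤ ·)

/-- The product `A a (σ a) * A (σ a) (σ² a) * ⋯ * A (σˡ a) a` along the cycle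
`(a, σ a, …, σˡ a)` of `σ`. -/
noncomputable def rowCycleProd (A : Matrix ι ι ℍ[ℝ]) (σ : Equiv.Perm ι) (a : ι) : ℍ[ℝ] :=
  ((List.range (Function.minimalPeriod σ a)).map
    fun t => A ((σ ^ t) a) ((σ ^ (t + 1)) a)).prod

/-- The product `A a (σˡ a) * ⋯ * A (σ² a) (σ a) * A (σ a) a` along the cycle
`(σˡ a, …, σ a, a)` of `σ`. -/
noncomputable def colCycleProd (A : Matrix ι ι ℍ[ℝ]) (σ : Equiv.Perm ι) (a : ι) : ℍ[ℝ] :=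
  ((List.range (Function.minimalPeriod σ a)).reverse.map
    fun t => A ((σ ^ (t + 1)) a) ((σ ^ t) a)).prod

/-- The `i`-th row determinant. The length of `leaders σ i` is the number of cycles of `σ`. -/
noncomputable def rdet (i : ι) (A : Matrix ι ι ℍ[ℝ]) : ℍ[ℝ] :=
  ∑ σ : Equiv.Perm ι, (-1) ^ (Fintype.card ι - (leaders σ i).length) *
    ((leaders σ i).map (rowCycleProd A σ)).prod

/-- The `j`-th column determinant. The cycles are written from right to left. -/
noncomputable def cdet (j : ι) (A : Matrix ι ι ℍ[ℝ]) : ℍ[ℝ] :=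
  ∑ τ : Equiv.Perm ι, (-1) ^ (Fintype.card ι - (leaders τ j).length) *
    ((leaders τ j).reverse.map (colCycleProd A τ)).prod

end Determinants

/-! ## Principal submatrices and principal minors -/

/-- The principal submatrix of `A` with rows and columns in `β`, indexed by `β` with the order
inherited from `Fin n`. -/
def principalSubmatrix {n : ℕ} (A : Matrix (Fin n) (Fin n) ℍ[ℝ]) (β : Finset (Fin n)) :
    Matrix β β ℍ[ℝ] :=
  A.submatrix Subtype.val Subtype.val

/-- The principal minor of a Hermitian matrix: the determinant of a principal submatrix. For a
Hermitian matrix all row and column determinants agree, and the row determinant along the first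
row is taken. The minor of order zero is `1`. -/
noncomputable def principalMinor {n : ℕ} (A : Matrix (Fin n) (Fin n) ℍ[ℝ])
    (β : Finset (Fin n)) : ℍ[ℝ] :=
  if h : β.Nonempty then rdet ⟨β.min' h, β.min'_mem h⟩ (principalSubmatrix A β) else 1

/-- The sum of all principal minors of order `r`. -/
noncomputable def principalMinorSum {n : ℕ} (r : ℕ) (A : Matrix (Fin n) (Fin n) ℍ[ℝ]) : ℍ[ℝ] :=
  ∑ β ∈ Finset.powersetCard r Finset.univ, principalMinor A β

/-- `∑ cdet_i ((A_{.i}(b))_β^β)` over all `β` of cardinality `r` containing `i`, where `A_{.i}(b)`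
is `A` with its `i`-th column replaced by `b`. -/
noncomputable def cdetSum {n : ℕ} (r : ℕ) (A : Matrix (Fin n) (Fin n) ℍ[ℝ]) (i : Fin n)
    (b : Fin n → ℍ[ℝ]) : ℍ[ℝ] :=
  ∑ β : {β : Finset (Fin n) // β.card = r ∧ i ∈ β},
    cdet ⟨i, β.2.2⟩ (principalSubmatrix (A.updateCol i b) β.1)

/-- `∑ rdet_j ((A_{j.}(b))_α^α)` over all `α` of cardinality `r` containing `j`, where `A_{j.}(b)`
is `A` with its `j`-th row replaced by `b`. -/
noncomputable def rdetSum {n : ℕ} (r : ℕ) (A : Matrix (Fin n) (Fin n) ℍ[ℝ]) (j : Fin n)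
    (b : Fin n → ℍ[ℝ]) : ℍ[ℝ] :=
  ∑ α : {α : Finset (Fin n) // α.card = r ∧ j ∈ α},
    rdet ⟨j, α.2.2⟩ (principalSubmatrix (A.updateRow j b) α.1)

/-! ## Rank, index and Drazin inverse -/

/-- The (column) rank: the dimension of the right `ℍ`-span of the columns. A right `ℍ`-vector
space is a module over the opposite ring. -/
noncomputable def rank {n m : ℕ} (A : Matrix (Fin n) (Fin m) ℍ[ℝ]) : ℕ :=
  Module.finrank ℍ[ℝ]ᵐᵒᵖ (Submodule.span ℍ[ℝ]ᵐᵒᵖ (Set.range A.col))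

/-- The index: the least `k ≥ 0` with `rank A ^ (k + 1) = rank A ^ k`. -/
noncomputable def index {n : ℕ} (A : Matrix (Fin n) (Fin n) ℍ[ℝ]) : ℕ :=
  sInf {k : ℕ | rank (A ^ (k + 1)) = rank (A ^ k)}

/-- The three defining equations of the Drazin inverse. -/
structure IsDrazinInverse {n : ℕ} (A X : Matrix (Fin n) (Fin n) ℍ[ℝ]) : Prop where
  pow_succ_mul : A ^ (index A + 1) * X = A ^ index A
  mul_mul_self : X * A * X = X
  comm : A * X = X * A

theorem IsDrazinInverse.eq_mul_mul {n : ℕ} {A X Y : Matrix (Fin n) (Fin n) ℍ[ℝ]}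
    (hX : IsDrazinInverse A X) (hY : IsDrazinInverse A Y) : X = X * A * Y := by
  have hc : Commute X A := hX.comm.symm
  have hid : ∀ m : ℕ, (X * A) ^ (m + 1) = X * A := by
    intro m
    induction m with
    | zero => simp
    | succ m ih => rw [pow_succ, ih, ← mul_assoc, hX.mul_mul_self]
  have h1 : X = X ^ (index A + 1) * A ^ index A := by
    calc X = X * A * X := hX.mul_mul_self.symm
      _ = X * (X * A) := by rw [mul_assoc, hX.comm]
      _ = X * (X * A) ^ (index A + 1) := by rw [hid]
      _ = (X * A) ^ index A * (X * (X * A)) := by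
        have : Commute X (X * A) := (Commute.refl X).mul_right hc
        rw [pow_succ, ← mul_assoc, (this.pow_right _).eq, mul_assoc]
      _ = (X * A) ^ index A * X := by
        rw [← mul_assoc X X A, mul_assoc X X A, ← hX.comm, ← mul_assoc X A X, hX.mul_mul_self]
      _ = X ^ (index A + 1) * A ^ index A := by
        rw [hc.mul_pow, mul_assoc, ← (hc.pow_right _).eq, ← mul_assoc, ← pow_succ]
  calc X = X ^ (index A + 1) * A ^ index A := h1
    _ = X ^ (index A + 1) * (A ^ (index A + 1) * Y) := by rw [hY.pow_succ_mul]
    _ = (X * A) ^ (index A + 1) * Y := by rw [hc.mul_pow, mul_assoc]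
    _ = X * A * Y := by rw [hid]

theorem IsDrazinInverse.eq_mul_mul' {n : ℕ} {A X Y : Matrix (Fin n) (Fin n) ℍ[ℝ]}
    (hX : IsDrazinInverse A X) (hY : IsDrazinInverse A Y) : Y = X * A * Y := by
  have hc : Commute Y A := hY.comm.symm
  have hcX : Commute X A := hX.comm.symm
  have hid : ∀ m : ℕ, Y = (A * Y) ^ m * Y := by
    intro m
    induction m with
    | zero => simp
    | succ m ih =>
      rw [pow_succ, mul_assoc, hY.comm, hY.mul_mul_self, ← hY.comm, ← ih]
  have h1 : Y = A ^ index A * Y ^ (index A + 1) := by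
    rw [pow_succ, ← mul_assoc, ← hc.symm.mul_pow]
    exact hid _
  have h3 : X * A ^ (index A + 1) = A ^ index A := by
    rw [(hcX.pow_right _).eq, hX.pow_succ_mul]
  calc Y = A ^ index A * Y ^ (index A + 1) := h1
    _ = X * A ^ (index A + 1) * Y ^ (index A + 1) := by rw [h3]
    _ = X * A * (A ^ index A * Y ^ (index A + 1)) := by
      simp only [pow_succ' A, mul_assoc]
    _ = X * A * Y := by rw [← h1]

theorem span_col_mul_le {n : ℕ} (A B : Matrix (Fin n) (Fin n) ℍ[ℝ]) :
    Submodule.span ℍ[ℝ]ᵐᵒᵖ (Set.range (A * B).col) ≤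
      Submodule.span ℍ[ℝ]ᵐᵒᵖ (Set.range A.col) := by
  rw [Submodule.span_le]
  rintro _ ⟨j, rfl⟩
  refine (Submodule.mem_span_range_iff_exists_fun _).2 ⟨fun l => MulOpposite.op (B l j), ?_⟩
  ext1 i
  simp [Matrix.mul_apply]

theorem exists_mul_of_span_col_le {n : ℕ} (A B : Matrix (Fin n) (Fin n) ℍ[ℝ])
    (h : Submodule.span ℍ[ℝ]ᵐᵒᵖ (Set.range B.col) ≤
      Submodule.span ℍ[ℝ]ᵐᵒᵖ (Set.range A.col)) : ∃ Y, B = A * Y := by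
  have h' : ∀ j, ∃ c : Fin n → ℍ[ℝ]ᵐᵒᵖ, ∑ l, c l • A.col l = B.col j := fun j =>
    (Submodule.mem_span_range_iff_exists_fun _).1 (h (Submodule.subset_span ⟨j, rfl⟩))
  choose c hc using h'
  refine ⟨Matrix.of fun l j => (c j l).unop, ?_⟩
  ext1 i j
  have := congrFun (hc j) i
  simp only [Finset.sum_apply, Pi.smul_apply, Matrix.col_apply] at this
  rw [← this]
  simp [Matrix.mul_apply, MulOpposite.smul_eq_mul_unop]

theorem finite_span_col {n : ℕ} (A : Matrix (Fin n) (Fin n) ℍ[ℝ]) :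
    Module.Finite ℍ[ℝ]ᵐᵒᵖ (Submodule.span ℍ[ℝ]ᵐᵒᵖ (Set.range A.col)) :=
  Module.Finite.span_of_finite _ (Set.finite_range _)

theorem rank_pow_index {n : ℕ} (A : Matrix (Fin n) (Fin n) ℍ[ℝ]) :
    rank (A ^ (index A + 1)) = rank (A ^ index A) := by
  have hne : {k : ℕ | rank (A ^ (k + 1)) = rank (A ^ k)}.Nonempty := by
    by_contra hempty
    have hlt : StrictAnti fun k => rank (A ^ k) := by
      refine strictAnti_nat_of_succ_lt fun k => lt_of_le_of_ne ?_ fun h => hempty ⟨k, h⟩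
      rw [pow_succ]
      have := finite_span_col (A ^ k)
      exact Submodule.finrank_mono (span_col_mul_le _ _)
    exact not_strictAnti_of_wellFoundedLT _ hlt
  exact Nat.sInf_mem hne

theorem exists_pow_eq {n : ℕ} (A : Matrix (Fin n) (Fin n) ℍ[ℝ]) :
    ∃ Y, A ^ index A = A ^ (index A + 1) * Y := by
  apply exists_mul_of_span_col_le
  have := finite_span_col (A ^ index A)
  refine (Submodule.eq_of_le_of_finrank_eq ?_ (rank_pow_index A)).ge
  rw [pow_succ]
  exact span_col_mul_le _ _

theorem existsUnique_isDrazinInverse {n : ℕ} (A : Matrix (Fin n) (Fin n) ℍ[ℝ]) :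
    ∃! X, IsDrazinInverse A X := by
  obtain ⟨d, y, hcomm, hy⟩ : ∃ (d : ℕ) (y : Matrix (Fin n) (Fin n) ℍ[ℝ]),
      Commute A y ∧ A ^ (d + 1) * y = A ^ d := by
    let a : Algebra.adjoin ℝ {A} := ⟨A, Algebra.subset_adjoin rfl⟩
    have : IsArtinian ℝ (Algebra.adjoin ℝ {A}) := inferInstance
    have : IsMulCommutative (Algebra.adjoin ℝ {A}) :=
      Algebra.isMulCommutative_adjoin ℝ (by simp)
    have : IsArtinianRing (Algebra.adjoin ℝ {A}) := IsArtinianRing.of_finite ℝ _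
    obtain ⟨d, y, h⟩ := IsArtinian.exists_pow_succ_smul_dvd a (1 : Algebra.adjoin ℝ {A})
    refine ⟨d, y, congrArg Subtype.val (mul_comm a y), ?_⟩
    simpa using congrArg Subtype.val h
  have hpow : ∀ m : ℕ, A ^ (d + m) * y ^ m = A ^ d := by
    intro m
    induction m with
    | zero => simp
    | succ m ih =>
      calc A ^ (d + (m + 1)) * y ^ (m + 1) = A ^ m * (A ^ (d + 1) * y) * y ^ m := by
            rw [pow_succ' y, ← mul_assoc, ← mul_assoc, ← pow_add]
            congr 3
            omega
        _ = A ^ (d + m) * y ^ m := by rw [hy, ← pow_add, add_comm]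
        _ = A ^ d := ih
  obtain ⟨X, hX1, hX2, hX3⟩ : ∃ X : Matrix (Fin n) (Fin n) ℍ[ℝ],
      A ^ (d + 1) * X = A ^ d ∧ X * A * X = X ∧ A * X = X * A := by
    have hXA : Commute A (A ^ d * y ^ (d + 1)) :=
      ((Commute.refl A).pow_right d).mul_right (hcomm.pow_right _)
    refine ⟨A ^ d * y ^ (d + 1), ?_, ?_, hXA⟩
    · rw [← mul_assoc, ← pow_add, ← hpow (d + 1)]
      congr 2
      omega
    · rw [← hXA.eq]
      calc A * (A ^ d * y ^ (d + 1)) * (A ^ d * y ^ (d + 1))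
          = A * A ^ d * (y ^ (d + 1) * A ^ d) * y ^ (d + 1) := by simp only [mul_assoc]
        _ = A ^ (d + (d + 1)) * y ^ (d + 1) * y ^ (d + 1) := by
          rw [← (hcomm.pow_pow d (d + 1)).eq, ← pow_succ', ← mul_assoc, ← pow_add]
          congr 3
          omega
        _ = A ^ d * y ^ (d + 1) := by rw [hpow]
  have hX : IsDrazinInverse A X := by
    refine ⟨?_, hX2, hX3⟩
    obtain ⟨Y, hY⟩ := exists_pow_eq A
    have hYpow : ∀ m : ℕ, A ^ index A = A ^ (index A + m) * Y ^ m := by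
      intro m
      induction m with
      | zero => simp
      | succ m ih =>
        calc A ^ index A = A ^ m * A ^ index A * Y ^ m := by
              rw [← pow_add, add_comm m]; exact ih
          _ = A ^ m * (A ^ (index A + 1) * Y) * Y ^ m := by rw [← hY]
          _ = A ^ (index A + (m + 1)) * Y ^ (m + 1) := by
              rw [pow_succ' Y, ← mul_assoc, ← mul_assoc, ← pow_add]
              congr 3
              omega
    have hXA : Commute A X := hX3
    calc A ^ (index A + 1) * X = X * A * A ^ index A := by
          rw [(hXA.pow_left _).eq, pow_succ', mul_assoc]
      _ = X * A * (A ^ (index A + d) * Y ^ d) := by rw [← hYpow]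
      _ = (X * A ^ (d + 1)) * A ^ index A * Y ^ d := by
          simp only [pow_succ', pow_add, mul_assoc, (Commute.pow_pow_self A (index A) d).left_comm]
      _ = A ^ d * A ^ index A * Y ^ d := by rw [← (hXA.pow_left _).eq, hX1]
      _ = A ^ index A := by rw [← pow_add, add_comm d, ← hYpow]
  exact ⟨X, hX, fun Z hZ => (IsDrazinInverse.eq_mul_mul hZ hX).trans
    (IsDrazinInverse.eq_mul_mul' hZ hX).symm⟩

/-- The Drazin inverse. -/
noncomputable def drazinInverse {n : ℕ} (A : Matrix (Fin n) (Fin n) ℍ[ℝ]) :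
    Matrix (Fin n) (Fin n) ℍ[ℝ] :=
  (existsUnique_isDrazinInverse A).choose

theorem isDrazinInverse_drazinInverse {n : ℕ} (A : Matrix (Fin n) (Fin n) ℍ[ℝ]) :
    IsDrazinInverse A (drazinInverse A) :=
  (existsUnique_isDrazinInverse A).choose_spec.1

end QuatDrazin

/-!
For a Hermitian matrix `M` and a set `S` of indices, let `M_S` be the principal submatrix on `S`. The
row determinant of `M_S` along `i` is left-linear in the `i`-th row, so it defines cofactors
`cof M S k i`. Removing `i` from the cycle through `i` of a permutation (`rdetOn_expand`) gives the
recursion `cof_row_rec`,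

  `cof M S k i = -∑ l ∈ S.erase k, M k l * cof M (S.erase k) l i` for `k ≠ i`,

with `cof M S i i = detOn M (S.erase i)`. The combinatorics of permutations is not used beyond this
point. By induction on `S`, the determinants `detOn M S` are real, the matrix of cofactors is
Hermitian, and it is the adjugate of `M_S` (`adjugateIdentity`). The delicate point is that the row
determinants along all indices agree (`rdetOn_eq_rdetOn`): comparing the two bracketings of
`M_S * cof M S * M_S` shows that they agree along `i` and `j` if `M i j ≠ 0`; otherwise `S` splits
into two blocks without entries between them, and all row determinants of `M_S` are the product of
the determinants of the blocks.

Summed over all `S` of cardinality `r`, the cofactors give a matrix `adjSum r M` and the determinants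
a real number `minorSum r M`, and these satisfy the Faddeev–LeVerrier recursion
`adjSum (r + 1) M = minorSum r M • 1 - M * adjSum r M` (`adjSum_succ`). If `s` is the largest order
with `minorSum s M ≠ 0`, the recursion makes `(minorSum s M)⁻¹ • (M * adjSum s M)` an idempotent with
the column space of `M` whose trace has real part `s`, so that `s = rank M` and
`M * M * adjSum s M = minorSum s M • M` (`minorSum_rank_ne_zero_and_sq_mul_adjSum`).

For `M = A ^ (k + 1)`, where `k` is the index of `A`, the Drazin inverse of `A` is the product of
`M` and one of its own powers, and therefore `adjSum s M * A ^ k = minorSum s M • drazinInverse A`, and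
likewise on the other side. Sums of column (row) determinants with a replaced column (row) are
products of `adjSum` with that column (row), so both numerators are the entries of
`adjSum r₁ (A ^ (k₁ + 1)) * A ^ k₁ * D * B ^ k₂ * adjSum r₂ (B ^ (k₂ + 1))`.
-/

namespace QuatDrazin

/-! ### Cycles and cycle products -/

section Cycles

variable {α : Type*}

theorem sameCycle_iff_exists_nat [Finite α] {σ : Equiv.Perm α} {a b : α} :
    σ.SameCycle a b ↔ ∃ t : ℕ, (σ ^ t) a = b :=
  ⟨fun h => h.exists_nat_pow_eq, fun ⟨t, h⟩ => ⟨t, by simpa using h⟩⟩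

theorem minimalPeriod_pos [Finite α] (σ : Equiv.Perm α) (a : α) : 0 < Function.minimalPeriod σ a :=
  Function.minimalPeriod_pos_of_mem_periodicPts
    (Function.Injective.mem_periodicPts σ.injective a)

theorem pow_minimalPeriod_apply (σ : Equiv.Perm α) (a : α) :
    (σ ^ Function.minimalPeriod σ a) a = a := by
  rw [← Equiv.Perm.iterate_eq_pow, Function.iterate_minimalPeriod]

theorem pow_apply_ne_self {σ : Equiv.Perm α} {a : α} {t : ℕ} (h0 : t ≠ 0)
    (ht : t < Function.minimalPeriod σ a) :
    (σ ^ t) a ≠ a := by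
  have := Function.not_isPeriodicPt_of_pos_of_lt_minimalPeriod h0 ht
  rwa [Function.IsPeriodicPt, Function.IsFixedPt, Equiv.Perm.iterate_eq_pow] at this

theorem pow_apply_ne_of_fixed {σ : Equiv.Perm α} {i k : α} (hi : σ i = i) (hk : k ≠ i)
    (t : ℕ) : (σ ^ t) k ≠ i := by
  intro h
  exact hk ((σ ^ t).injective (h.trans (Equiv.Perm.pow_apply_eq_self_of_apply_eq_self hi t).symm))

theorem rowCycleProd_congr {M M' : Matrix α α ℍ[ℝ]} {σ σ' : Equiv.Perm α} {a : α}
    (hσ : ∀ t : ℕ, (σ ^ t) a = (σ' ^ t) a)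
    (hM : ∀ t : ℕ, M ((σ ^ t) a) ((σ ^ (t + 1)) a) = M' ((σ ^ t) a) ((σ ^ (t + 1)) a)) :
    rowCycleProd M σ a = rowCycleProd M' σ' a := by
  have hp : Function.minimalPeriod σ a = Function.minimalPeriod σ' a := by
    rw [Function.minimalPeriod_eq_minimalPeriod_iff]
    intro t
    simp only [Function.IsPeriodicPt, Function.IsFixedPt, Equiv.Perm.iterate_eq_pow, hσ]
  simp only [rowCycleProd, hp, hM]
  simp only [hσ]

theorem rowCycleProd_of_fixed {σ : Equiv.Perm α} {i : α} (M : Matrix α α ℍ[ℝ]) (hi : σ i = i) :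
    rowCycleProd M σ i = M i i := by
  have : Function.minimalPeriod σ i = 1 := Function.minimalPeriod_eq_one_iff_isFixedPt.2 hi
  simp [rowCycleProd, this, hi]

end Cycles

/-! ### Determinants of principal submatrices as sums over permutations -/

section Contraction

variable {ι : Type*} [Fintype ι] [LinearOrder ι]

/-- The permutations of `ι` that fix every point outside `S`; they stand for the permutations
of `S`. -/
def permsOn (S : Finset ι) : Finset (Equiv.Perm ι) :=
  Finset.univ.filter fun σ => ∀ a, a ∉ S → σ a = a

/-- The least elements of the cycles of `σ` inside `S`, in increasing order. -/
def cycleMins (S : Finset ι) (σ : Equiv.Perm ι) : List ι :=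
  (S.filter fun a => ∀ b, σ.SameCycle a b → a ≤ b).sort (· ≤ ·)

/-- The least elements, in increasing order, of the cycles of `σ` inside `S` that do not
contain `i`. -/
def otherMins (S : Finset ι) (σ : Equiv.Perm ι) (i : ι) : List ι :=
  (S.filter fun a => ¬ σ.SameCycle i a ∧ ∀ b, σ.SameCycle a b → a ≤ b).sort (· ≤ ·)

/-- The `i`-th row determinant of the principal submatrix of `M` on `S`, as a sum over permutations
of the whole index type. The sign exponent has the parity of `S.card` minus the number of
cycles. -/
noncomputable def rdetOn (M : Matrix ι ι ℍ[ℝ]) (S : Finset ι) (i : ι) : ℍ[ℝ] :=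
  ∑ σ ∈ permsOn S, (-1) ^ (S.card + (otherMins S σ i).length + 1) *
    (rowCycleProd M σ i * ((otherMins S σ i).map (rowCycleProd M σ)).prod)

/-- The row determinant along the least index of the principal submatrix of `M` on `S`; it is `1`
for `S = ∅`. -/
noncomputable def detOn (M : Matrix ι ι ℍ[ℝ]) (S : Finset ι) : ℍ[ℝ] :=
  ∑ σ ∈ permsOn S, (-1) ^ (S.card + (cycleMins S σ).length) *
    ((cycleMins S σ).map (rowCycleProd M σ)).prod

theorem mem_permsOn {S : Finset ι} {σ : Equiv.Perm ι} :
    σ ∈ permsOn S ↔ ∀ a, a ∉ S → σ a = a := by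
  simp [permsOn]

theorem apply_mem_of_mem_permsOn {S : Finset ι} {σ : Equiv.Perm ι} (hσ : σ ∈ permsOn S) {a : ι}
    (ha : a ∈ S) : σ a ∈ S := by
  by_contra h
  exact h (by rwa [σ.injective (mem_permsOn.1 hσ _ h)])

theorem pow_apply_mem_of_mem_permsOn {S : Finset ι} {σ : Equiv.Perm ι} (hσ : σ ∈ permsOn S)
    {a : ι} (ha : a ∈ S) (t : ℕ) : (σ ^ t) a ∈ S := by
  induction t with
  | zero => simpa
  | succ t ih => rw [pow_succ', Equiv.Perm.mul_apply]; exact apply_mem_of_mem_permsOn hσ ih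

theorem mem_of_sameCycle {S : Finset ι} {σ : Equiv.Perm ι} (hσ : σ ∈ permsOn S) {a b : ι}
    (ha : a ∈ S) (h : σ.SameCycle a b) : b ∈ S := by
  obtain ⟨t, rfl⟩ := h.exists_nat_pow_eq
  exact pow_apply_mem_of_mem_permsOn hσ ha t

theorem mem_otherMins {S : Finset ι} {σ : Equiv.Perm ι} {i a : ι} :
    a ∈ otherMins S σ i ↔ a ∈ S ∧ ¬ σ.SameCycle i a ∧ ∀ b, σ.SameCycle a b → a ≤ b := by
  simp [otherMins]

theorem mem_cycleMins {S : Finset ι} {σ : Equiv.Perm ι} {a : ι} :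
    a ∈ cycleMins S σ ↔ a ∈ S ∧ ∀ b, σ.SameCycle a b → a ≤ b := by
  simp [cycleMins]

theorem rdetOn_congr {M M' : Matrix ι ι ℍ[ℝ]} {S : Finset ι} {i : ι} (hi : i ∈ S)
    (h : ∀ a ∈ S, ∀ b ∈ S, M a b = M' a b) : rdetOn M S i = rdetOn M' S i := by
  refine Finset.sum_congr rfl fun σ hσ => ?_
  have key : ∀ a ∈ S, rowCycleProd M σ a = rowCycleProd M' σ a := fun a ha =>
    rowCycleProd_congr (fun _ => rfl) fun t => h _ (pow_apply_mem_of_mem_permsOn hσ ha _) _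
      (pow_apply_mem_of_mem_permsOn hσ ha _)
  rw [key i hi, List.map_congr_left fun a ha => key a (mem_otherMins.1 ha).1]

theorem detOn_congr {M M' : Matrix ι ι ℍ[ℝ]} {S : Finset ι}
    (h : ∀ a ∈ S, ∀ b ∈ S, M a b = M' a b) : detOn M S = detOn M' S := by
  refine Finset.sum_congr rfl fun σ hσ => ?_
  have key : ∀ a ∈ S, rowCycleProd M σ a = rowCycleProd M' σ a := fun a ha =>
    rowCycleProd_congr (fun _ => rfl) fun t => h _ (pow_apply_mem_of_mem_permsOn hσ ha _) _
      (pow_apply_mem_of_mem_permsOn hσ ha _)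
  rw [List.map_congr_left fun a ha => key a (mem_cycleMins.1 ha).1]

theorem detOn_empty (M : Matrix ι ι ℍ[ℝ]) : detOn M ∅ = 1 := by
  have h : permsOn (∅ : Finset ι) = {1} := by
    ext σ
    simp [mem_permsOn, Equiv.Perm.ext_iff]
  simp [detOn, h, cycleMins]

theorem cycleMins_eq_cons {S : Finset ι} (hS : S.Nonempty) {σ : Equiv.Perm ι}
    (hσ : σ ∈ permsOn S) : cycleMins S σ = S.min' hS :: otherMins S σ (S.min' hS) := by
  unfold cycleMins otherMins
  rw [← Finset.sort_insert]
  · congr 1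
    ext a
    simp only [Finset.mem_filter, Finset.mem_insert]
    constructor
    · rintro ⟨ha, h⟩
      by_cases hc : σ.SameCycle (S.min' hS) a
      · exact Or.inl (le_antisymm (h _ hc.symm) (S.min'_le _ ha))
      · exact Or.inr ⟨ha, hc, h⟩
    · rintro (rfl | ⟨ha, -, h⟩)
      · exact ⟨S.min'_mem hS, fun b hb => S.min'_le _ (mem_of_sameCycle hσ (S.min'_mem hS) hb)⟩
      · exact ⟨ha, h⟩
  · exact fun b hb => S.min'_le _ (Finset.mem_filter.1 hb).1
  · simp [Equiv.Perm.SameCycle.rfl]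

theorem detOn_eq_rdetOn_min {S : Finset ι} (hS : S.Nonempty) (M : Matrix ι ι ℍ[ℝ]) :
    detOn M S = rdetOn M S (S.min' hS) := by
  refine Finset.sum_congr rfl fun σ hσ => ?_
  rw [cycleMins_eq_cons hS hσ]
  simp [add_assoc]

/-! ### Contraction of a permutation -/

section

variable {σ : Equiv.Perm ι} {i k : ι}

omit [Fintype ι] in
/-- In `swap i k * σ`, with `i` fixed by `σ`, the cycle of `k` under `σ` is entered from `i`. -/
theorem swap_mul_pow_succ_apply (hi : σ i = i) (hk : k ≠ i) {t : ℕ}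
    (ht : t < Function.minimalPeriod σ k) :
    ((Equiv.swap i k * σ) ^ (t + 1)) i = (σ ^ t) k := by
  induction t with
  | zero => simp [hi]
  | succ t ih =>
    rw [pow_succ', Equiv.Perm.mul_apply, ih (by omega), Equiv.Perm.mul_apply,
      ← Equiv.Perm.mul_apply σ, ← pow_succ',
      Equiv.swap_apply_of_ne_of_ne (pow_apply_ne_of_fixed hi hk _)
        (pow_apply_ne_self (by omega) ht)]

theorem swap_mul_pow_minimalPeriod_apply (hi : σ i = i) (hk : k ≠ i) :
    ((Equiv.swap i k * σ) ^ (Function.minimalPeriod σ k + 1)) i = i := by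
  have hp := minimalPeriod_pos σ k
  obtain ⟨p, hp'⟩ : ∃ p, Function.minimalPeriod σ k = p + 1 := ⟨_, (Nat.succ_pred hp.ne').symm⟩
  rw [pow_succ', Equiv.Perm.mul_apply, hp', swap_mul_pow_succ_apply hi hk (by omega),
    Equiv.Perm.mul_apply, ← Equiv.Perm.mul_apply σ, ← pow_succ', ← hp', pow_minimalPeriod_apply,
    Equiv.swap_apply_right]

theorem minimalPeriod_swap_mul (hi : σ i = i) (hk : k ≠ i) :
    Function.minimalPeriod (Equiv.swap i k * σ) i = Function.minimalPeriod σ k + 1 := by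
  apply le_antisymm
  · apply Function.IsPeriodicPt.minimalPeriod_le (Nat.succ_pos _)
    rw [Function.IsPeriodicPt, Function.IsFixedPt, Equiv.Perm.iterate_eq_pow]
    exact swap_mul_pow_minimalPeriod_apply hi hk
  · by_contra! h
    have h0 := minimalPeriod_pos (Equiv.swap i k * σ) i
    obtain ⟨p, hp⟩ : ∃ p, Function.minimalPeriod (Equiv.swap i k * σ) i = p + 1 :=
      ⟨_, (Nat.succ_pred h0.ne').symm⟩
    have h1 := pow_minimalPeriod_apply (Equiv.swap i k * σ) i
    rw [hp, swap_mul_pow_succ_apply hi hk (by omega)] at h1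
    exact pow_apply_ne_of_fixed hi hk _ h1

/-- Inserting `i` before `k` opens the cycle product with the entry `M i k`; the last factor of the
old cycle then ends in `i` instead of `k`. -/
theorem rowCycleProd_swap_mul (M : Matrix ι ι ℍ[ℝ]) (hi : σ i = i) (hk : k ≠ i) :
    rowCycleProd M (Equiv.swap i k * σ) i =
      M i k * rowCycleProd (M.updateCol k fun a => M a i) σ k := by
  have hp := minimalPeriod_pos σ k
  rw [rowCycleProd, rowCycleProd, minimalPeriod_swap_mul hi hk, List.range_succ_eq_map,
    List.map_cons, List.prod_cons, List.map_map]
  congr 1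
  · rw [swap_mul_pow_succ_apply hi hk hp]
    simp
  · congr 1
    refine List.map_congr_left fun t ht => ?_
    rw [List.mem_range] at ht
    simp only [Function.comp]
    rw [swap_mul_pow_succ_apply hi hk ht]
    rcases Nat.lt_or_ge (t + 1) (Function.minimalPeriod σ k) with h | h
    · rw [swap_mul_pow_succ_apply hi hk h, Matrix.updateCol_ne (pow_apply_ne_self (by omega) h)]
    · have h' : t + 1 = Function.minimalPeriod σ k := by omega
      rw [Nat.succ_eq_add_one, h', swap_mul_pow_minimalPeriod_apply hi hk,
        pow_minimalPeriod_apply, Matrix.updateCol_self]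

theorem sameCycle_swap_mul_self_iff (hi : σ i = i) (hk : k ≠ i) {a : ι} :
    (Equiv.swap i k * σ).SameCycle i a ↔ a = i ∨ σ.SameCycle k a := by
  constructor
  · intro h
    obtain ⟨t, rfl⟩ := h.exists_nat_pow_eq
    clear h
    induction t with
    | zero => simp
    | succ t ih =>
      rw [pow_succ', Equiv.Perm.mul_apply]
      rcases ih with h | h
      · rw [h]; simp [hi, Equiv.Perm.SameCycle.rfl]
      · set b := ((Equiv.swap i k * σ) ^ t) i
        rw [Equiv.Perm.mul_apply]
        by_cases h1 : σ b = k
        · simp [h1]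
        · by_cases h2 : σ b = i
          · simp [h2, Equiv.Perm.SameCycle.rfl]
          · rw [Equiv.swap_apply_of_ne_of_ne h2 h1]
            exact Or.inr (Equiv.Perm.sameCycle_apply_right.2 h)
  · rintro (rfl | h)
    · exact Equiv.Perm.SameCycle.rfl
    · obtain ⟨t, rfl⟩ := h.exists_nat_pow_eq
      refine sameCycle_iff_exists_nat.2 ⟨t % Function.minimalPeriod σ k + 1, ?_⟩
      rw [swap_mul_pow_succ_apply hi hk (Nat.mod_lt _ (minimalPeriod_pos σ k)),
        ← Equiv.Perm.iterate_eq_pow, Function.iterate_mod_minimalPeriod_eq,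
        Equiv.Perm.iterate_eq_pow]

theorem swap_mul_pow_apply_of_not_sameCycle (hi : σ i = i) {a : ι} (hai : a ≠ i)
    (ha : ¬ σ.SameCycle k a) (t : ℕ) : ((Equiv.swap i k * σ) ^ t) a = (σ ^ t) a := by
  induction t with
  | zero => simp
  | succ t ih =>
    rw [pow_succ', Equiv.Perm.mul_apply, ih, Equiv.Perm.mul_apply, ← Equiv.Perm.mul_apply σ,
      ← pow_succ', Equiv.swap_apply_of_ne_of_ne (pow_apply_ne_of_fixed hi hai _)]
    intro h
    exact ha (sameCycle_iff_exists_nat.2 ⟨_, h⟩).symm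

theorem otherMins_swap_mul (S : Finset ι) (hi : σ i = i) (hk : k ≠ i) :
    otherMins S (Equiv.swap i k * σ) i = otherMins (S.erase i) σ k := by
  unfold otherMins
  congr 1
  ext a
  simp only [Finset.mem_filter, Finset.mem_erase, sameCycle_swap_mul_self_iff hi hk, not_or]
  have : a ≠ i → ¬ σ.SameCycle k a →
      ∀ b, (Equiv.swap i k * σ).SameCycle a b ↔ σ.SameCycle a b := by
    intro h1 h2 b
    simp only [sameCycle_iff_exists_nat, swap_mul_pow_apply_of_not_sameCycle hi h1 h2]
  constructor
  · rintro ⟨h1, ⟨h2, h3⟩, h4⟩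
    exact ⟨⟨h2, h1⟩, h3, fun b hb => h4 b ((this h2 h3 b).2 hb)⟩
  · rintro ⟨⟨h2, h1⟩, h3, h4⟩
    exact ⟨h1, ⟨h2, h3⟩, fun b hb => h4 b ((this h2 h3 b).1 hb)⟩

theorem otherMins_of_fixed (S : Finset ι) (hi : σ i = i) :
    otherMins S σ i = cycleMins (S.erase i) σ := by
  unfold otherMins cycleMins
  congr 1
  ext a
  have : σ.SameCycle i a ↔ a = i :=
    ⟨fun h => (h.eq_of_left hi).symm, fun h => h ▸ Equiv.Perm.SameCycle.rfl⟩
  simp only [Finset.mem_filter, Finset.mem_erase, this]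
  tauto

end

/-- A permutation `σ` of `S` is determined by `σ i` and by `swap i (σ i) * σ`, which fixes `i`. -/
theorem permsOn_sum_eq {S : Finset ι} {i : ι} (hi : i ∈ S) (f : Equiv.Perm ι → ℍ[ℝ]) :
    ∑ σ ∈ permsOn S, f σ =
      ∑ k ∈ S, ∑ σ ∈ permsOn (S.erase i), f (Equiv.swap i k * σ) := by
  rw [← Finset.sum_product']
  refine Finset.sum_nbij' (fun σ => (σ i, Equiv.swap i (σ i) * σ))
    (fun p => Equiv.swap i p.1 * p.2) ?_ ?_ ?_ ?_ ?_
  · intro σ hσ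
    rw [Finset.mem_product, mem_permsOn]
    refine ⟨apply_mem_of_mem_permsOn hσ hi, fun a ha => ?_⟩
    by_cases hai : a = i
    · subst hai; simp
    · have haS : a ∉ S := fun h => ha (Finset.mem_erase.2 ⟨hai, h⟩)
      have := mem_permsOn.1 hσ a haS
      simp only [Equiv.Perm.mul_apply, this]
      refine Equiv.swap_apply_of_ne_of_ne hai fun h => hai (σ.injective (this.trans h))
  · rintro ⟨k, σ⟩ h
    rw [Finset.mem_product] at h
    refine mem_permsOn.2 fun a ha => ?_
    have h1 : σ a = a := mem_permsOn.1 h.2 a fun h' => ha (Finset.mem_of_mem_erase h')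
    rw [Equiv.Perm.mul_apply, h1]
    exact Equiv.swap_apply_of_ne_of_ne (fun h' => ha (h' ▸ hi)) (fun h' => ha (h' ▸ h.1))
  · intro σ _
    simp [← mul_assoc]
  · rintro ⟨k, σ⟩ h
    rw [Finset.mem_product] at h
    have h1 : σ i = i := mem_permsOn.1 h.2 i (Finset.notMem_erase i S)
    simp [h1, ← mul_assoc]
  · intro σ _
    simp [← mul_assoc]

/-- Expansion of a row determinant along its row. The terms with `σ i = k ≠ i` are those of the
row determinant on `S.erase i` along `k`, with the `k`-th column replaced by the `i`-th one: the
cycle `(i, k, …)` is shortened by removing `i`. -/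
theorem rdetOn_expand (M : Matrix ι ι ℍ[ℝ]) {S : Finset ι} {i : ι} (hi : i ∈ S) :
    rdetOn M S i = M i i * detOn M (S.erase i) -
      ∑ k ∈ S.erase i, M i k * rdetOn (M.updateCol k fun a => M a i) (S.erase i) k := by
  have hcard : S.card = (S.erase i).card + 1 := (Finset.card_erase_add_one hi).symm
  rw [rdetOn, permsOn_sum_eq hi, ← Finset.add_sum_erase _ _ hi, sub_eq_add_neg,
    ← Finset.sum_neg_distrib]
  congr 1
  · rw [detOn, Finset.mul_sum]
    refine Finset.sum_congr rfl fun σ hσ => ?_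
    have h1 : σ i = i := mem_permsOn.1 hσ i (Finset.notMem_erase i S)
    rw [Equiv.swap_self, ← Equiv.Perm.one_def, one_mul, otherMins_of_fixed S h1,
      rowCycleProd_of_fixed M h1, hcard]
    rcases neg_one_pow_eq_or ℍ[ℝ] ((S.erase i).card + (cycleMins (S.erase i) σ).length) with h | h
    · rw [show (S.erase i).card + 1 + (cycleMins (S.erase i) σ).length + 1 =
        (S.erase i).card + (cycleMins (S.erase i) σ).length + 2 by ring, pow_add, h]
      simp
    · rw [show (S.erase i).card + 1 + (cycleMins (S.erase i) σ).length + 1 =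
        (S.erase i).card + (cycleMins (S.erase i) σ).length + 2 by ring, pow_add, h]
      simp
  · refine Finset.sum_congr rfl fun k hk => ?_
    rw [rdetOn, Finset.mul_sum, ← Finset.sum_neg_distrib]
    refine Finset.sum_congr rfl fun σ hσ => ?_
    have h1 : σ i = i := mem_permsOn.1 hσ i (Finset.notMem_erase i S)
    have hki : k ≠ i := Finset.ne_of_mem_erase hk
    have h2 : (otherMins (S.erase i) σ k).map (rowCycleProd M (Equiv.swap i k * σ)) =
        (otherMins (S.erase i) σ k).map (rowCycleProd (M.updateCol k fun a => M a i) σ) := by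
      refine List.map_congr_left fun a ha => ?_
      obtain ⟨h3, h4, -⟩ := mem_otherMins.1 ha
      refine rowCycleProd_congr
        (swap_mul_pow_apply_of_not_sameCycle h1 (Finset.ne_of_mem_erase h3) h4) fun t => ?_
      rw [Matrix.updateCol_ne]
      rw [swap_mul_pow_apply_of_not_sameCycle h1 (Finset.ne_of_mem_erase h3) h4]
      exact fun h => h4 (sameCycle_iff_exists_nat.2 ⟨_, h⟩).symm
    rw [otherMins_swap_mul S h1 hki, rowCycleProd_swap_mul M h1 hki, h2, hcard]
    rw [show (S.erase i).card + 1 + (otherMins (S.erase i) σ k).length + 1 =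
        (S.erase i).card + (otherMins (S.erase i) σ k).length + 1 + 1 by ring, pow_succ]
    rcases neg_one_pow_eq_or ℍ[ℝ] ((S.erase i).card + (otherMins (S.erase i) σ k).length + 1)
      with h | h <;> rw [h] <;> simp [mul_assoc]

end Contraction

/-! ### Comparison with the row and column determinants -/

section Restriction

variable {ι : Type*} [Fintype ι] [LinearOrder ι]

/-- A permutation of `S` as a permutation of the whole index type. -/
def extendPerm (S : Finset ι) (τ : Equiv.Perm S) : Equiv.Perm ι :=
  Equiv.Perm.ofSubtype τ

omit [Fintype ι] in
theorem extendPerm_pow_apply {S : Finset ι} (τ : Equiv.Perm S) (t : ℕ) (a : S) :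
    ((extendPerm S τ) ^ t) a = ((τ ^ t) a : S) := by
  rw [extendPerm, ← map_pow]
  exact Equiv.Perm.ofSubtype_apply_coe (τ ^ t) a

theorem extendPerm_mem_permsOn {S : Finset ι} (τ : Equiv.Perm S) : extendPerm S τ ∈ permsOn S :=
  mem_permsOn.2 fun _ ha => Equiv.Perm.ofSubtype_apply_of_not_mem τ ha

theorem sum_permsOn {S : Finset ι} (f : Equiv.Perm ι → ℍ[ℝ]) :
    ∑ σ ∈ permsOn S, f σ = ∑ τ : Equiv.Perm S, f (extendPerm S τ) := by
  symm
  refine Finset.sum_nbij (extendPerm S) (fun τ _ => extendPerm_mem_permsOn τ)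
    (fun _ _ _ _ h => Equiv.Perm.ofSubtype_injective h) ?_ fun _ _ => rfl
  intro σ hσ
  have h := mem_permsOn.1 (Finset.mem_coe.1 hσ)
  have h1 : ∀ x, σ x ∈ S ↔ x ∈ S := fun x =>
    ⟨fun hx => by by_contra hc; rw [h x hc] at hx; exact hc hx,
      fun hx => apply_mem_of_mem_permsOn (Finset.mem_coe.1 hσ) hx⟩
  refine ⟨σ.subtypePerm h1, by simp, ?_⟩
  exact Equiv.Perm.ofSubtype_subtypePerm h1 fun x hx => by
    by_contra hc; exact hx (h x hc)

theorem sameCycle_extendPerm {S : Finset ι} (τ : Equiv.Perm S) (a b : S) :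
    (extendPerm S τ).SameCycle a b ↔ τ.SameCycle a b := by
  simp only [sameCycle_iff_exists_nat, extendPerm_pow_apply, Subtype.ext_iff]

omit [Fintype ι] in
theorem rowCycleProd_extendPerm (M : Matrix ι ι ℍ[ℝ]) {S : Finset ι} (τ : Equiv.Perm S) (a : S) :
    rowCycleProd M (extendPerm S τ) a =
      rowCycleProd (M.submatrix Subtype.val Subtype.val : Matrix S S ℍ[ℝ]) τ a := by
  have hp : Function.minimalPeriod (extendPerm S τ) a = Function.minimalPeriod τ a := by
    rw [Function.minimalPeriod_eq_minimalPeriod_iff]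
    intro t
    simp only [Function.IsPeriodicPt, Function.IsFixedPt, Equiv.Perm.iterate_eq_pow,
      extendPerm_pow_apply, Subtype.ext_iff]
  simp only [rowCycleProd, hp, extendPerm_pow_apply, Matrix.submatrix_apply]

theorem leaders_map_val {S : Finset ι} (τ : Equiv.Perm S) (i : S) :
    (leaders τ i).map Subtype.val = (i : ι) :: otherMins S (extendPerm S τ) i := by
  have hmem : ∀ b : ι, ∀ a : S, (extendPerm S τ).SameCycle a b → b ∈ S := fun b a h =>
    mem_of_sameCycle (extendPerm_mem_permsOn τ) a.2 h
  rw [leaders, List.map_cons, otherMins]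
  congr 1
  have := Finset.map_sort (Function.Embedding.subtype (· ∈ S))
    (Finset.univ.filter fun a : S => ¬ τ.SameCycle i a ∧ ∀ b, τ.SameCycle a b → a ≤ b)
    (· ≤ ·) (· ≤ ·) (fun a _ b _ => Iff.rfl)
  refine this.trans ?_
  congr 1
  ext a
  simp only [Finset.mem_map, Finset.mem_filter, Finset.mem_univ, true_and]
  constructor
  · rintro ⟨a, ⟨h1, h2⟩, rfl⟩
    refine ⟨a.2, fun h => h1 ((sameCycle_extendPerm τ i a).1 h), fun b hb => ?_⟩
    exact h2 ⟨b, hmem b a hb⟩ ((sameCycle_extendPerm τ a ⟨b, hmem b a hb⟩).1 hb)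
  · rintro ⟨ha, h1, h2⟩
    refine ⟨⟨a, ha⟩, ⟨fun h => h1 ((sameCycle_extendPerm τ i ⟨a, ha⟩).2 h), fun b hb => ?_⟩, rfl⟩
    exact h2 b ((sameCycle_extendPerm τ ⟨a, ha⟩ b).2 hb)

theorem rdet_submatrix (M : Matrix ι ι ℍ[ℝ]) {S : Finset ι} {i : ι} (hi : i ∈ S) :
    rdet ⟨i, hi⟩ (M.submatrix Subtype.val Subtype.val : Matrix S S ℍ[ℝ]) = rdetOn M S i := by
  rw [rdetOn, sum_permsOn, rdet]
  refine Finset.sum_congr rfl fun τ _ => ?_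
  have hl := leaders_map_val τ ⟨i, hi⟩
  have hlen : (leaders τ ⟨i, hi⟩).length = (otherMins S (extendPerm S τ) i).length + 1 := by
    rw [← List.length_map (f := Subtype.val), hl, List.length_cons]
  have hle : (otherMins S (extendPerm S τ) i).length + 1 ≤ S.card := by
    rw [otherMins, Finset.length_sort, ← Finset.card_erase_add_one hi]
    refine Nat.succ_le_succ (Finset.card_le_card fun a ha => ?_)
    simp only [Finset.mem_filter] at ha
    refine Finset.mem_erase.2 ⟨?_, ha.1⟩
    rintro rfl
    exact ha.2.1 Equiv.Perm.SameCycle.rfl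
  have hprod : (leaders τ ⟨i, hi⟩).map
      (rowCycleProd (M.submatrix Subtype.val Subtype.val : Matrix S S ℍ[ℝ]) τ) =
      ((i : ι) :: otherMins S (extendPerm S τ) i).map (rowCycleProd M (extendPerm S τ)) := by
    rw [← hl, List.map_map]
    exact List.map_congr_left fun a _ => (rowCycleProd_extendPerm M τ a).symm
  rw [hprod, hlen, Fintype.card_coe, List.map_cons, List.prod_cons]
  congr 1
  -- By `hle` the subtraction of natural numbers in the exponent does not truncate.
  obtain ⟨c, hc⟩ := Nat.exists_eq_add_of_le hle
  rw [hc, Nat.add_sub_cancel_left]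
  rw [show (otherMins S (extendPerm S τ) i).length + 1 + c +
    (otherMins S (extendPerm S τ) i).length + 1 =
      c + 2 * ((otherMins S (extendPerm S τ) i).length + 1) by ring, pow_add, pow_mul]
  simp

end Restriction

theorem principalMinor_eq_detOn {n : ℕ} (M : Matrix (Fin n) (Fin n) ℍ[ℝ]) (S : Finset (Fin n)) :
    principalMinor M S = detOn M S := by
  unfold principalMinor
  split_ifs with h
  · rw [detOn_eq_rdetOn_min h]
    exact rdet_submatrix M _
  · rw [Finset.not_nonempty_iff_eq_empty.1 h, detOn_empty]

theorem star_list_prod (l : List ℍ[ℝ]) : star l.prod = (l.reverse.map star).prod := by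
  induction l with
  | nil => simp
  | cons x l ih => simp [star_mul, ih]

theorem colCycleProd_eq_star {ι : Type*} (M : Matrix ι ι ℍ[ℝ]) (σ : Equiv.Perm ι) (a : ι) :
    colCycleProd M σ a = star (rowCycleProd M.conjTranspose σ a) := by
  rw [colCycleProd, rowCycleProd, star_list_prod, ← List.map_reverse, List.map_map]
  congr 1
  refine List.map_congr_left fun t _ => ?_
  simp [Matrix.conjTranspose_apply]

/-- Column determinants are conjugates of row determinants of the conjugate transpose. -/
theorem cdet_eq_star_rdet {ι : Type*} [Fintype ι] [LinearOrder ι] (j : ι) (M : Matrix ι ι ℍ[ℝ]) :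
    cdet j M = star (rdet j M.conjTranspose) := by
  rw [cdet, rdet, star_sum]
  refine Finset.sum_congr rfl fun τ _ => ?_
  rw [star_mul, star_list_prod, ← List.map_reverse, List.map_map]
  have : star ∘ rowCycleProd M.conjTranspose τ = colCycleProd M τ :=
    funext fun a => (colCycleProd_eq_star M τ a).symm
  rw [this]
  rcases neg_one_pow_eq_or ℍ[ℝ] (Fintype.card ι - (leaders τ j).length) with h | h <;>
    rw [h] <;> simp

/-! ### Cofactors -/

section Cofactors

variable {ι : Type*} [Fintype ι] [LinearOrder ι]

/-- The `(k, i)` entry of the adjugate of the principal submatrix of `M` on `S`: the coefficient of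
`b k` in the row determinant along `i` with `i`-th row `b`. It is `0` unless `k, i ∈ S`. -/
noncomputable def cof (M : Matrix ι ι ℍ[ℝ]) (S : Finset ι) : Matrix ι ι ℍ[ℝ] := fun k i =>
  if k ∈ S ∧ i ∈ S then
    if k = i then detOn M (S.erase i) else -rdetOn (M.updateCol k fun a => M a i) (S.erase i) k
  else 0

variable {M : Matrix ι ι ℍ[ℝ]} {S : Finset ι} {i k : ι}

theorem cof_self (hi : i ∈ S) : cof M S i i = detOn M (S.erase i) := by
  simp [cof, hi]

theorem cof_of_ne (hk : k ∈ S) (hi : i ∈ S) (hki : k ≠ i) :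
    cof M S k i = -rdetOn (M.updateCol k fun a => M a i) (S.erase i) k := by
  simp [cof, hk, hi, hki]

theorem cof_eq_zero_left (hk : k ∉ S) : cof M S k i = 0 := by
  simp [cof, hk]

theorem cof_eq_zero_right (hi : i ∉ S) : cof M S k i = 0 := by
  simp [cof, hi]

theorem rdetOn_updateRow (b : ι → ℍ[ℝ]) (hi : i ∈ S) :
    rdetOn (M.updateRow i b) S i = ∑ l ∈ S, b l * cof M S l i := by
  rw [rdetOn_expand _ hi, ← Finset.add_sum_erase _ _ hi, cof_self hi, Matrix.updateRow_self,
    sub_eq_add_neg, ← Finset.sum_neg_distrib]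
  congr 1
  · congr 1
    exact detOn_congr fun a ha c _ => by rw [Matrix.updateRow_ne (Finset.ne_of_mem_erase ha)]
  · refine Finset.sum_congr rfl fun k hk => ?_
    rw [cof_of_ne (Finset.mem_of_mem_erase hk) hi (Finset.ne_of_mem_erase hk), mul_neg]
    congr 2
    refine rdetOn_congr hk fun a ha c _ => ?_
    have hai := Finset.ne_of_mem_erase ha
    simp only [Matrix.updateCol_apply, Matrix.updateRow_ne hai]

theorem rdetOn_eq_sum_cof (hi : i ∈ S) : rdetOn M S i = ∑ l ∈ S, M i l * cof M S l i := by
  rw [← rdetOn_updateRow (M i) hi, Matrix.updateRow_eq_self]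

/-- The off-diagonal cofactors satisfy a recursion that removes the row index; it is the first step
of a self-avoiding path from `k` to `i`. -/
theorem cof_row_rec (hk : k ∈ S) (hi : i ∈ S) (hki : k ≠ i) :
    cof M S k i = -∑ l ∈ S.erase k, M k l * cof M (S.erase k) l i := by
  have hk' : k ∈ S.erase i := Finset.mem_erase.2 ⟨hki, hk⟩
  have hi' : i ∈ S.erase k := Finset.mem_erase.2 ⟨hki.symm, hi⟩
  rw [cof_of_ne hk hi hki, rdetOn_expand _ hk', ← Finset.add_sum_erase _ _ hi', cof_self hi',
    Finset.erase_right_comm, Matrix.updateCol_self, sub_eq_add_neg, ← Finset.sum_neg_distrib]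
  congr 2
  · congr 1
    refine detOn_congr fun a _ c hc => ?_
    rw [Matrix.updateCol_ne (Finset.ne_of_mem_erase (Finset.mem_of_mem_erase hc))]
  · refine Finset.sum_congr rfl fun l hl => ?_
    have hlk : l ≠ k := Finset.ne_of_mem_erase (Finset.mem_of_mem_erase hl)
    rw [cof_of_ne (Finset.mem_of_mem_erase hl) hi' (Finset.ne_of_mem_erase hl), mul_neg,
      Matrix.updateCol_ne hlk]
    congr 2
    refine rdetOn_congr hl fun a _ c hc => ?_
    have hck : c ≠ k := Finset.ne_of_mem_erase (Finset.mem_of_mem_erase hc)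
    simp only [Matrix.updateCol_apply, hck, if_false, if_true]

end Cofactors

/-! ### Hermitian matrices -/

section Hermitian

theorem exists_real_of_star_eq {x : ℍ[ℝ]} (h : star x = x) : ∃ r : ℝ, x = (r : ℍ[ℝ]) :=
  ⟨x.re, (Quaternion.star_eq_self.1 h)⟩

theorem mul_comm_of_star_eq {x : ℍ[ℝ]} (h : star x = x) (y : ℍ[ℝ]) : x * y = y * x := by
  obtain ⟨r, rfl⟩ := exists_real_of_star_eq h
  exact Quaternion.coe_commutes r y

variable {ι : Type*} [Fintype ι] [LinearOrder ι] {M : Matrix ι ι ℍ[ℝ]} {S : Finset ι} {i j k : ι}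

/-- The companion of `cof_row_rec` that removes the column index (the last step of a path). -/
theorem cof_col_rec (hreal : ∀ T ⊂ S, star (detOn M T) = detOn M T)
    (hk : k ∈ S) (hi : i ∈ S) (hki : k ≠ i) :
    cof M S k i = -∑ l ∈ S.erase i, cof M (S.erase i) k l * M l i := by
  induction S using Finset.strongInduction generalizing k i with
  | H S ih =>
    have hk' : k ∈ S.erase i := Finset.mem_erase.2 ⟨hki, hk⟩
    have hi' : i ∈ S.erase k := Finset.mem_erase.2 ⟨hki.symm, hi⟩
    have hsub : (S.erase k).erase i ⊂ S :=
      (Finset.erase_subset _ _).trans_ssubset (Finset.erase_ssubset hk)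
    rw [cof_row_rec hk hi hki, ← Finset.add_sum_erase _ _ hi', ← Finset.add_sum_erase _ _ hk',
      cof_self hi', cof_self hk', Finset.erase_right_comm (a := i) (b := k),
      mul_comm_of_star_eq (hreal _ hsub)]
    congr 2
    have h1 : ∀ l ∈ (S.erase k).erase i, M k l * cof M (S.erase k) l i =
        ∑ p ∈ (S.erase k).erase i, -(M k l * cof M ((S.erase k).erase i) l p * M p i) := by
      intro l hl
      rw [ih _ (Finset.erase_ssubset hk)
        (fun T hT => hreal T (hT.trans (Finset.erase_ssubset hk))) (Finset.mem_of_mem_erase hl) hi'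
        (Finset.ne_of_mem_erase hl), mul_neg, Finset.mul_sum, ← Finset.sum_neg_distrib]
      simp only [mul_assoc]
    have h2 : ∀ p ∈ (S.erase k).erase i, cof M (S.erase i) k p * M p i =
        ∑ l ∈ (S.erase k).erase i, -(M k l * cof M ((S.erase k).erase i) l p * M p i) := by
      intro p hp
      have hpk := Finset.mem_of_mem_erase hp
      rw [cof_row_rec hk' (Finset.mem_erase.2 ⟨Finset.ne_of_mem_erase hp,
        Finset.mem_of_mem_erase hpk⟩) (Finset.ne_of_mem_erase hpk).symm, neg_mul, Finset.sum_mul,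
        ← Finset.sum_neg_distrib, Finset.erase_right_comm]
    rw [Finset.sum_congr rfl h1, Finset.sum_congr rfl h2, Finset.sum_comm]

theorem star_cof (hM : M.IsHermitian) (hreal : ∀ T ⊂ S, star (detOn M T) = detOn M T) (k i : ι) :
    star (cof M S k i) = cof M S i k := by
  induction S using Finset.strongInduction generalizing k i with
  | H S ih =>
    by_cases hk : k ∈ S
    swap
    · rw [cof_eq_zero_left hk, cof_eq_zero_right hk, star_zero]
    by_cases hi : i ∈ S
    swap
    · rw [cof_eq_zero_left hi, cof_eq_zero_right hi, star_zero]
    by_cases hki : k = i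
    · subst hki
      rw [cof_self hk, hreal _ (Finset.erase_ssubset hk)]
    · rw [cof_row_rec hk hi hki, cof_col_rec hreal hi hk (Ne.symm hki), star_neg, star_sum]
      congr 1
      refine Finset.sum_congr rfl fun l _ => ?_
      rw [star_mul, ih _ (Finset.erase_ssubset hk)
        (fun T hT => hreal T (hT.trans (Finset.erase_ssubset hk))), hM.apply]

/-- The product of the principal submatrix of `M` on `S` with its adjugate is the scalar matrix of `detOn M S`, and `detOn M S` is real. -/
def AdjugateIdentity (M : Matrix ι ι ℍ[ℝ]) (S : Finset ι) : Prop :=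
  star (detOn M S) = detOn M S ∧
    ∀ i ∈ S, ∀ j ∈ S, ∑ l ∈ S, M i l * cof M S l j = if i = j then detOn M S else 0

theorem AdjugateIdentity.rdetOn_eq (h : AdjugateIdentity M S) (hi : i ∈ S) :
    rdetOn M S i = detOn M S := by
  rw [rdetOn_eq_sum_cof hi, h.2 i hi i hi, if_pos rfl]

/-- A row determinant of a matrix with two equal rows vanishes. -/
theorem sum_mul_cof_of_ne (hM : ∀ T ⊂ S, AdjugateIdentity M T) (hi : i ∈ S) (hj : j ∈ S)
    (hij : i ≠ j) : ∑ l ∈ S, M i l * cof M S l j = 0 := by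
  have hT := hM _ (Finset.erase_ssubset hj)
  have hi' : i ∈ S.erase j := Finset.mem_erase.2 ⟨hij, hi⟩
  have h1 : ∀ l ∈ S.erase j, M i l * cof M S l j =
      ∑ p ∈ S.erase j, -(M i l * cof M (S.erase j) l p * M p j) := by
    intro l hl
    rw [cof_col_rec (fun T hT => (hM T hT).1) (Finset.mem_of_mem_erase hl) hj
      (Finset.ne_of_mem_erase hl), mul_neg, Finset.mul_sum, ← Finset.sum_neg_distrib]
    simp only [mul_assoc]
  have h2 : ∀ p ∈ S.erase j, ∑ l ∈ S.erase j, -(M i l * cof M (S.erase j) l p * M p j) =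
      if i = p then -(detOn M (S.erase j) * M p j) else 0 := by
    intro p hp
    rw [Finset.sum_neg_distrib, ← Finset.sum_mul, hT.2 i hi' p hp]
    split_ifs <;> simp
  rw [← Finset.add_sum_erase _ _ hj, Finset.sum_congr rfl h1, Finset.sum_comm,
    Finset.sum_congr rfl h2, Finset.sum_ite_eq, if_pos hi', cof_self hj,
    mul_comm_of_star_eq hT.1]
  simp

theorem star_rdetOn (hherm : M.IsHermitian) (hM : ∀ T ⊂ S, AdjugateIdentity M T) (hi : i ∈ S) :
    star (rdetOn M S i) = rdetOn M S i := by
  have hreal : ∀ T ⊂ S, star (detOn M T) = detOn M T := fun T hT => (hM T hT).1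
  have h1 : ∀ l ∈ S.erase i, M i l * cof M S l i =
      ∑ p ∈ S.erase i, -(M i l * cof M (S.erase i) l p * M p i) := by
    intro l hl
    rw [cof_col_rec hreal (Finset.mem_of_mem_erase hl) hi
      (Finset.ne_of_mem_erase hl), mul_neg, Finset.mul_sum, ← Finset.sum_neg_distrib]
    simp only [mul_assoc]
  rw [rdetOn_eq_sum_cof hi, ← Finset.add_sum_erase _ _ hi, Finset.sum_congr rfl h1, star_add,
    star_mul, cof_self hi, hreal _ (Finset.erase_ssubset hi), hherm.apply,
    mul_comm_of_star_eq (hreal _ (Finset.erase_ssubset hi))]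
  congr 1
  simp only [star_sum, star_neg, star_mul, hherm.apply, star_cof hherm
    (fun T hT => hreal T (hT.trans (Finset.erase_ssubset hi))), mul_assoc]
  exact Finset.sum_comm

/-- Both ways of bracketing `M_S * cof M S * M_S`. -/
theorem rdetOn_mul_entry (hherm : M.IsHermitian) (hM : ∀ T ⊂ S, AdjugateIdentity M T) (hi : i ∈ S)
    (hj : j ∈ S) : rdetOn M S i * M i j = M i j * rdetOn M S j := by
  have hreal : ∀ T ⊂ S, star (detOn M T) = detOn M T := fun T hT => (hM T hT).1
  have h1 : ∀ p ∈ S, ∀ i ∈ S, ∑ l ∈ S, M i l * cof M S l p =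
      if i = p then rdetOn M S p else 0 := by
    intro p hp i hi
    split_ifs with h
    · subst h; exact (rdetOn_eq_sum_cof hi).symm
    · exact sum_mul_cof_of_ne hM hi hp h
  have h2 : ∀ l ∈ S, ∑ p ∈ S, cof M S l p * M p j = if l = j then rdetOn M S j else 0 := by
    intro l hl
    have := congrArg star (h1 l hl j hj)
    rw [star_sum] at this
    simp only [star_mul, hherm.apply, star_cof hherm hreal] at this
    rw [this]
    split_ifs with h3 h4 h4
    · subst h3; exact star_rdetOn hherm hM hl
    · exact absurd h3.symm h4
    · exact absurd h4.symm h3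
    · exact star_zero _
  calc rdetOn M S i * M i j
      = ∑ p ∈ S, (∑ l ∈ S, M i l * cof M S l p) * M p j := by
        rw [Finset.sum_congr rfl fun p hp => by rw [h1 p hp i hi, ite_mul, zero_mul],
          Finset.sum_ite_eq, if_pos hi]
    _ = ∑ l ∈ S, M i l * ∑ p ∈ S, cof M S l p * M p j := by
        simp only [Finset.sum_mul, Finset.mul_sum, mul_assoc]
        exact Finset.sum_comm
    _ = M i j * rdetOn M S j := by
        rw [Finset.sum_congr rfl fun l hl => by rw [h2 l hl, mul_ite, mul_zero],
          Finset.sum_ite_eq', if_pos hj]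

/-- The row determinant of a block diagonal matrix. -/
theorem rdetOn_union_of_cof {S₁ S₂ : Finset ι} (hd : Disjoint S₁ S₂)
    (h0 : ∀ a ∈ S₁, ∀ b ∈ S₂, M a b = 0) (hi : i ∈ S₁)
    (hcof : ∀ l ∈ S₁, cof M (S₁ ∪ S₂) l i = cof M S₁ l i * detOn M S₂) :
    rdetOn M (S₁ ∪ S₂) i = rdetOn M S₁ i * detOn M S₂ := by
  rw [rdetOn_eq_sum_cof (Finset.mem_union_left _ hi), rdetOn_eq_sum_cof hi,
    Finset.sum_union hd, Finset.sum_eq_zero (s := S₂) fun l hl => by rw [h0 i hi l hl, zero_mul],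
    add_zero, Finset.sum_mul]
  exact Finset.sum_congr rfl fun l hl => by rw [hcof l hl, mul_assoc]

/-- The cofactors of a block diagonal matrix. -/
theorem cof_union {S₁ S₂ : Finset ι} (hd : Disjoint S₁ S₂)
    (h0 : ∀ a ∈ S₁, ∀ b ∈ S₂, M a b = 0) (hM : ∀ T ⊂ S₁ ∪ S₂, AdjugateIdentity M T)
    {l : ι} (hl : l ∈ S₁) (hi : i ∈ S₁) : cof M (S₁ ∪ S₂) l i = cof M S₁ l i * detOn M S₂ := by
  induction S₁ using Finset.strongInduction generalizing l i with
  | H S₁ ih =>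
    have hrec : ∀ a ∈ S₁, ∀ l ∈ S₁.erase a, ∀ i ∈ S₁.erase a,
        cof M (S₁.erase a ∪ S₂) l i = cof M (S₁.erase a) l i * detOn M S₂ := by
      intro a ha l hl i hi
      refine ih _ (Finset.erase_ssubset ha) (hd.mono_left (Finset.erase_subset _ _))
        (fun b hb => h0 b (Finset.mem_of_mem_erase hb)) (fun T hT => hM T ?_) hl hi
      exact hT.trans_subset (Finset.union_subset_union_left (Finset.erase_subset _ _))
    have herase : ∀ a ∈ S₁, (S₁ ∪ S₂).erase a = S₁.erase a ∪ S₂ := by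
      intro a ha
      rw [Finset.erase_union_distrib, Finset.erase_eq_of_notMem
        (Finset.disjoint_left.1 hd ha)]
    have hss : ∀ a ∈ S₁, S₁.erase a ∪ S₂ ⊂ S₁ ∪ S₂ := fun a ha =>
      herase a ha ▸ Finset.erase_ssubset (Finset.mem_union_left _ ha)
    by_cases hli : l = i
    · subst hli
      rw [cof_self (Finset.mem_union_left _ hl), cof_self hl, herase l hl]
      rcases (S₁.erase l).eq_empty_or_nonempty with he | ⟨p, hp⟩
      · simp [he, detOn_empty]
      · rw [← (hM _ (hss l hl)).rdetOn_eq (Finset.mem_union_left _ hp),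
          ← (hM _ (Finset.subset_union_left.trans_ssubset (hss l hl))).rdetOn_eq hp]
        exact rdetOn_union_of_cof (hd.mono_left (Finset.erase_subset _ _))
          (fun b hb => h0 b (Finset.mem_of_mem_erase hb)) hp fun q hq => hrec l hl q hq p hp
    · have hi' : i ∈ S₁.erase l := Finset.mem_erase.2 ⟨Ne.symm hli, hi⟩
      rw [cof_row_rec (Finset.mem_union_left _ hl) (Finset.mem_union_left _ hi) hli,
        cof_row_rec hl hi hli, herase l hl,
        Finset.sum_union (hd.mono_left (Finset.erase_subset _ _)),
        Finset.sum_eq_zero (s := S₂) fun q hq => by rw [h0 l hl q hq, zero_mul], add_zero, neg_mul,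
        Finset.sum_mul]
      congr 1
      exact Finset.sum_congr rfl fun q hq => by rw [hrec l hl q hq i hi', mul_assoc]

/-- All row determinants of a Hermitian matrix agree. The indices whose row determinant equals that
of `i` form a set `S₁` without nonzero entries to its complement `S₂` in `S`; if `S₂` were
nonempty, the matrix would be block diagonal and all row determinants would be
`detOn M S₁ * detOn M S₂`. -/
theorem rdetOn_eq_rdetOn (hherm : M.IsHermitian) (hM : ∀ T ⊂ S, AdjugateIdentity M T) (hi : i ∈ S)
    (hj : j ∈ S) : rdetOn M S i = rdetOn M S j := by
  classical
  by_contra hne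
  set S₁ := S.filter fun a => rdetOn M S a = rdetOn M S i with hS₁
  set S₂ := S.filter fun a => ¬ rdetOn M S a = rdetOn M S i with hS₂
  have hunion : S₁ ∪ S₂ = S := Finset.filter_union_filter_not_eq _ _
  have hd : Disjoint S₁ S₂ := Finset.disjoint_filter_filter_not _ _ _
  have hi₁ : i ∈ S₁ := Finset.mem_filter.2 ⟨hi, rfl⟩
  have hj₂ : j ∈ S₂ := Finset.mem_filter.2 ⟨hj, fun h => hne h.symm⟩
  have h12 : ∀ a ∈ S₁, ∀ b ∈ S₂, M a b = 0 := by
    intro a ha b hb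
    rw [hS₁, Finset.mem_filter] at ha
    rw [hS₂, Finset.mem_filter] at hb
    have h1 := rdetOn_mul_entry hherm hM ha.1 hb.1
    rw [← mul_comm_of_star_eq (star_rdetOn hherm hM hb.1), ← sub_eq_zero, ← sub_mul,
      mul_eq_zero, sub_eq_zero] at h1
    exact h1.resolve_left fun h => hb.2 (h ▸ ha.2)
  have h21 : ∀ a ∈ S₂, ∀ b ∈ S₁, M a b = 0 := fun a ha b hb => by
    rw [← hherm.apply, h12 b hb a ha, star_zero]
  have hs₁ : S₁ ⊂ S := Finset.filter_ssubset.2 ⟨j, hj, fun h => hne h.symm⟩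
  have hs₂ : S₂ ⊂ S := Finset.filter_ssubset.2 ⟨i, hi, fun h => h rfl⟩
  have e₁ : rdetOn M S i = detOn M S₁ * detOn M S₂ := by
    rw [← (hM _ hs₁).rdetOn_eq hi₁]
    have := rdetOn_union_of_cof hd h12 hi₁ fun l hl => cof_union hd h12 (hunion ▸ hM) hl hi₁
    rwa [hunion] at this
  have hunion' : S₂ ∪ S₁ = S := by rw [Finset.union_comm, hunion]
  have e₂ : rdetOn M S j = detOn M S₂ * detOn M S₁ := by
    rw [← (hM _ hs₂).rdetOn_eq hj₂]
    have := rdetOn_union_of_cof hd.symm h21 hj₂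
      fun l hl => cof_union hd.symm h21 (hunion' ▸ hM) hl hj₂
    rwa [hunion'] at this
  exact hne (by rw [e₁, e₂, mul_comm_of_star_eq (hM _ hs₁).1])

/-- The inverse formula for Hermitian quaternion matrices, without division by the determinant. -/
theorem adjugateIdentity (hherm : M.IsHermitian) (S : Finset ι) : AdjugateIdentity M S := by
  induction S using Finset.strongInduction with
  | H S hM =>
    rcases S.eq_empty_or_nonempty with rfl | hS
    · exact ⟨by simp [detOn_empty], by simp⟩
    have hdet : ∀ i ∈ S, rdetOn M S i = detOn M S := fun i hi => by
      rw [detOn_eq_rdetOn_min hS, rdetOn_eq_rdetOn hherm hM hi (S.min'_mem hS)]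
    refine ⟨?_, fun i hi j hj => ?_⟩
    · rw [detOn_eq_rdetOn_min hS]
      exact star_rdetOn hherm hM (S.min'_mem hS)
    · split_ifs with h
      · subst h
        rw [← rdetOn_eq_sum_cof hi, hdet i hi]
      · exact sum_mul_cof_of_ne hM hi hj h

theorem star_detOn (hherm : M.IsHermitian) (S : Finset ι) : star (detOn M S) = detOn M S :=
  (adjugateIdentity hherm S).1

end Hermitian

/-! ### Sums of principal minors and of adjugates -/

section Sums

variable {n : ℕ}

/-- The sum of the adjugates of all principal submatrices of order `r`. For a Hermitian matrix `M`
it is the coefficient of `t ^ (n - r)` in the adjugate of `t • 1 + M`. -/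
noncomputable def adjSum (r : ℕ) (M : Matrix (Fin n) (Fin n) ℍ[ℝ]) : Matrix (Fin n) (Fin n) ℍ[ℝ] :=
  ∑ S ∈ Finset.powersetCard r Finset.univ, cof M S

theorem principalMinorSum_eq (r : ℕ) (M : Matrix (Fin n) (Fin n) ℍ[ℝ]) :
    principalMinorSum r M = ∑ S ∈ Finset.powersetCard r Finset.univ, detOn M S := by
  simp only [principalMinorSum, principalMinor_eq_detOn]

theorem rdetSum_eq (r : ℕ) (M : Matrix (Fin n) (Fin n) ℍ[ℝ]) (j : Fin n) (b : Fin n → ℍ[ℝ]) :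
    rdetSum r M j b = ∑ l, b l * adjSum r M l j := by
  have h1 : ∀ S : Finset (Fin n), j ∈ S → rdetOn (M.updateRow j b) S j =
      ∑ l, b l * cof M S l j := by
    intro S hj
    rw [rdetOn_updateRow b hj]
    refine Finset.sum_subset (Finset.subset_univ _) fun l _ hl => ?_
    rw [cof_eq_zero_left hl, mul_zero]
  have h2 : ∑ l, b l * adjSum r M l j =
      ∑ S ∈ Finset.powersetCard r Finset.univ, ∑ l, b l * cof M S l j := by
    simp only [adjSum, Matrix.sum_apply, Finset.mul_sum]
    exact Finset.sum_comm
  have h3 : rdetSum r M j b = ∑ S : {S : Finset (Fin n) // S.card = r ∧ j ∈ S},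
      ∑ l, b l * cof M S.1 l j := by
    refine Finset.sum_congr rfl fun S _ => ?_
    rw [← h1 S.1 S.2.2]
    exact rdet_submatrix _ S.2.2
  rw [h2, h3, ← Finset.sum_subtype ((Finset.powersetCard r Finset.univ).filter fun S => j ∈ S)
    (p := fun S => S.card = r ∧ j ∈ S) (by simp [Finset.mem_powersetCard])
    (fun S => ∑ l, b l * cof M S l j)]
  refine Finset.sum_subset (Finset.filter_subset _ _) fun S hS hS' => ?_
  have : j ∉ S := fun h => hS' (Finset.mem_filter.2 ⟨hS, h⟩)
  exact Finset.sum_eq_zero fun l _ => by rw [cof_eq_zero_right this, mul_zero]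

theorem cdetSum_eq_star_rdetSum (r : ℕ) (M : Matrix (Fin n) (Fin n) ℍ[ℝ]) (i : Fin n)
    (b : Fin n → ℍ[ℝ]) :
    cdetSum r M i b = star (rdetSum r M.conjTranspose i (star b)) := by
  rw [cdetSum, rdetSum, star_sum]
  refine Finset.sum_congr rfl fun S _ => ?_
  rw [cdet_eq_star_rdet, principalSubmatrix, principalSubmatrix, Matrix.conjTranspose_submatrix,
    Matrix.updateRow_conjTranspose]

variable {M : Matrix (Fin n) (Fin n) ℍ[ℝ]}

theorem adjSum_isHermitian (hM : M.IsHermitian) (r : ℕ) : (adjSum r M).IsHermitian := by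
  ext1 i j
  rw [Matrix.conjTranspose_apply, adjSum, Matrix.sum_apply, Matrix.sum_apply, star_sum]
  exact Finset.sum_congr rfl fun S _ => star_cof hM (fun T _ => star_detOn hM T) j i

theorem cdetSum_eq (hM : M.IsHermitian) (r : ℕ) (i : Fin n) (b : Fin n → ℍ[ℝ]) :
    cdetSum r M i b = ∑ l, adjSum r M i l * b l := by
  rw [cdetSum_eq_star_rdetSum, hM.eq, rdetSum_eq, star_sum]
  refine Finset.sum_congr rfl fun l _ => ?_
  rw [star_mul, Pi.star_apply, star_star, (adjSum_isHermitian hM r).apply]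

/-- The real part of `principalMinorSum r M`; for Hermitian `M` it is the whole sum. -/
noncomputable def minorSum (r : ℕ) (M : Matrix (Fin n) (Fin n) ℍ[ℝ]) : ℝ :=
  (principalMinorSum r M).re

theorem principalMinorSum_eq_coe (hM : M.IsHermitian) (r : ℕ) :
    principalMinorSum r M = (minorSum r M : ℍ[ℝ]) := by
  refine Quaternion.star_eq_self.1 ?_
  rw [principalMinorSum_eq, star_sum]
  exact Finset.sum_congr rfl fun S _ => star_detOn hM S

theorem minorSum_zero : minorSum 0 M = 1 := by
  simp [minorSum, principalMinorSum_eq, detOn_empty]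

theorem adjSum_zero : adjSum 0 M = 0 := by
  ext1 i j
  simp [adjSum, cof_eq_zero_left]

theorem adjSum_of_lt {r : ℕ} (h : n < r) : adjSum r M = 0 := by
  rw [adjSum, Finset.powersetCard_eq_empty.2 (by simpa), Finset.sum_empty]

/-- The sets of cardinality `r + 1` through `i` are the `insert i S`. -/
theorem sum_powersetCard_succ_mem (r : ℕ) (i : Fin n) (f : Finset (Fin n) → ℍ[ℝ]) :
    ∑ S ∈ (Finset.powersetCard (r + 1) Finset.univ).filter (fun S => i ∈ S), f S =
      ∑ S ∈ (Finset.powersetCard r Finset.univ).filter (fun S => i ∉ S), f (insert i S) := by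
  refine Finset.sum_nbij' (fun S => S.erase i) (fun S => insert i S) ?_ ?_ ?_ ?_ ?_
  · intro S hS
    simp only [Finset.mem_filter, Finset.mem_powersetCard_univ] at hS ⊢
    exact ⟨by rw [Finset.card_erase_of_mem hS.2, hS.1, Nat.add_sub_cancel],
      Finset.notMem_erase _ _⟩
  · intro S hS
    simp only [Finset.mem_filter, Finset.mem_powersetCard_univ] at hS ⊢
    exact ⟨by rw [Finset.card_insert_of_notMem hS.2, hS.1], Finset.mem_insert_self _ _⟩
  · intro S hS
    exact Finset.insert_erase (Finset.mem_filter.1 hS).2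
  · intro S hS
    exact Finset.erase_insert (Finset.mem_filter.1 hS).2
  · intro S hS
    rw [Finset.insert_erase (Finset.mem_filter.1 hS).2]

theorem adjSum_succ_apply (r : ℕ) (i j : Fin n) :
    adjSum (r + 1) M i j = ∑ S ∈ (Finset.powersetCard r Finset.univ).filter (fun S => i ∉ S),
      cof M (insert i S) i j := by
  rw [← sum_powersetCard_succ_mem r i fun S => cof M S i j, adjSum, Matrix.sum_apply]
  symm
  refine Finset.sum_subset (Finset.filter_subset _ _) fun S hS hS' => ?_
  have hi : i ∉ S := fun h => hS' (Finset.mem_filter.2 ⟨hS, h⟩)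
  exact cof_eq_zero_left hi

/-- A row of `M` inside `S` is multiplied to a row of the scalar matrix of `detOn M S`. A row
outside `S` produces, by the recursion for cofactors, a row of the adjugate on `insert i S`. -/
theorem sum_mul_cof (hM : M.IsHermitian) (S : Finset (Fin n)) (i j : Fin n) :
    ∑ l, M i l * cof M S l j =
      (if i = j then detOn M S else 0) - if i ∈ S then 0 else cof M (insert i S) i j := by
  have h0 : ∑ l, M i l * cof M S l j = ∑ l ∈ S, M i l * cof M S l j := by
    symm
    refine Finset.sum_subset (Finset.subset_univ _) fun l _ hl => ?_
    rw [cof_eq_zero_left hl, mul_zero]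
  rw [h0]
  by_cases hi : i ∈ S
  · rw [if_pos hi, sub_zero]
    by_cases hj : j ∈ S
    · exact (adjugateIdentity hM S).2 i hi j hj
    · rw [if_neg fun h : i = j => hj (h ▸ hi)]
      exact Finset.sum_eq_zero fun l _ => by rw [cof_eq_zero_right hj, mul_zero]
  · rw [if_neg hi]
    by_cases hij : i = j
    · subst hij
      rw [if_pos rfl, cof_self (Finset.mem_insert_self _ _), Finset.erase_insert hi, sub_self]
      exact Finset.sum_eq_zero fun l _ => by rw [cof_eq_zero_right hi, mul_zero]
    · rw [if_neg hij, zero_sub]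
      by_cases hj : j ∈ S
      · rw [cof_row_rec (Finset.mem_insert_self _ _) (Finset.mem_insert_of_mem hj) hij,
          Finset.erase_insert hi, neg_neg]
      · have hj' : j ∉ insert i S := by simp [hj, Ne.symm hij]
        rw [cof_eq_zero_right hj', neg_zero]
        exact Finset.sum_eq_zero fun l _ => by rw [cof_eq_zero_right hj, mul_zero]

/-- The Faddeev–LeVerrier recursion. -/
theorem adjSum_succ (hM : M.IsHermitian) (r : ℕ) :
    adjSum (r + 1) M = minorSum r M • (1 : Matrix (Fin n) (Fin n) ℍ[ℝ]) - M * adjSum r M := by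
  rw [eq_sub_iff_add_eq, ← eq_sub_iff_add_eq']
  ext1 i j
  rw [Matrix.mul_apply, Matrix.sub_apply, adjSum_succ_apply, Matrix.smul_apply, Matrix.one_apply]
  have h1 : ∑ l, M i l * adjSum r M l j =
      ∑ S ∈ Finset.powersetCard r Finset.univ, ∑ l, M i l * cof M S l j := by
    simp only [adjSum, Matrix.sum_apply, Finset.mul_sum]
    exact Finset.sum_comm
  rw [h1, Finset.sum_congr rfl fun S _ => sum_mul_cof hM S i j, Finset.sum_sub_distrib,
    Finset.sum_filter]
  congr 1
  · split_ifs with h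
    · rw [← principalMinorSum_eq, principalMinorSum_eq_coe hM, Algebra.smul_def, mul_one]
      rfl
    · simp
  · refine Finset.sum_congr rfl fun S _ => ?_
    split_ifs <;> rfl

theorem commute_adjSum (hM : M.IsHermitian) (r : ℕ) : Commute M (adjSum r M) := by
  induction r with
  | zero => rw [adjSum_zero]; exact Commute.zero_right M
  | succ r ih =>
    rw [adjSum_succ hM]
    exact ((Commute.one_right M).smul_right _).sub_right ((Commute.refl M).mul_right ih)

/-- Each principal minor of order `r` is a diagonal cofactor for the `n - r` indices outside it. -/
theorem trace_adjSum_succ {r : ℕ} (hr : r ≤ n) :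
    (Matrix.trace (adjSum (r + 1) M)).re = (n - r : ℝ) * minorSum r M := by
  have h1 : Matrix.trace (adjSum (r + 1) M) =
      ∑ S ∈ Finset.powersetCard r Finset.univ, (n - r : ℝ) • detOn M S := by
    rw [Matrix.trace]
    have : ∀ i : Fin n, (adjSum (r + 1) M).diag i =
        ∑ S ∈ Finset.powersetCard r Finset.univ, if i ∉ S then detOn M S else 0 := by
      intro i
      rw [Matrix.diag_apply, adjSum_succ_apply, ← Finset.sum_filter]
      refine Finset.sum_congr rfl fun S hS => ?_
      rw [cof_self (Finset.mem_insert_self _ _),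
        Finset.erase_insert (Finset.mem_filter.1 hS).2]
    rw [Finset.sum_congr rfl fun i _ => this i, Finset.sum_comm]
    refine Finset.sum_congr rfl fun S hS => ?_
    have hc : (Finset.univ.filter fun i => i ∉ S).card = n - r := by
      rw [← Finset.compl_filter, Finset.card_compl, Fintype.card_fin,
        Finset.filter_mem_eq_inter, Finset.univ_inter, (Finset.mem_powersetCard_univ.1 hS)]
    rw [← Finset.sum_filter, Finset.sum_const, hc, ← Nat.cast_sub hr, Nat.cast_smul_eq_nsmul]
  rw [h1, ← Finset.smul_sum, ← principalMinorSum_eq, Quaternion.re_smul, minorSum, smul_eq_mul]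

end Sums

/-! ### Rank and trace of idempotents -/

section Idempotent

variable {n : ℕ}

/-- Multiplication by a quaternion matrix as a real-linear map. -/
noncomputable def realMulVec (E : Matrix (Fin n) (Fin n) ℍ[ℝ]) :
    (Fin n → ℍ[ℝ]) →ₗ[ℝ] (Fin n → ℍ[ℝ]) where
  toFun := E.mulVec
  map_add' := E.mulVec_add
  map_smul' c x := E.mulVec_smul c x

theorem re_sum {α : Type*} (s : Finset α) (f : α → ℍ[ℝ]) :
    (∑ a ∈ s, f a).re = ∑ a ∈ s, (f a).re :=
  map_sum (⟨⟨fun x => x.re, Quaternion.re_zero⟩, Quaternion.re_add⟩ : ℍ[ℝ] →+ ℝ) f s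

/-- The basis `1, i, j, k`. -/
noncomputable def quaternionBasis : Module.Basis (Fin 4) ℝ ℍ[ℝ] :=
  QuaternionAlgebra.basisOneIJK (-1 : ℝ) 0 (-1)

/-- The trace of left multiplication by `q` on the four-dimensional space `ℍ[ℝ]`. -/
theorem trace_mulLeft (q : ℍ[ℝ]) :
    ∑ c, quaternionBasis.repr (q * quaternionBasis c) c = 4 * q.re := by
  have hr : ∀ x : ℍ[ℝ], quaternionBasis.repr x = ![x.re, x.imI, x.imJ, x.imK] :=
    QuaternionAlgebra.coe_basisOneIJK_repr (-1 : ℝ) 0 (-1)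
  have hb : ∀ c d, ![(quaternionBasis c).re, (quaternionBasis c).imI, (quaternionBasis c).imJ,
      (quaternionBasis c).imK] d = if c = d then 1 else 0 := by
    intro c d
    rw [← hr, Module.Basis.repr_self, Finsupp.single_apply]
  have h0 : ∀ c, (quaternionBasis c).re = if c = 0 then 1 else 0 := fun c => hb c 0
  have h1 : ∀ c, (quaternionBasis c).imI = if c = 1 then 1 else 0 := fun c => hb c 1
  have h2 : ∀ c, (quaternionBasis c).imJ = if c = 2 then 1 else 0 := fun c => hb c 2
  have h3 : ∀ c, (quaternionBasis c).imK = if c = 3 then 1 else 0 := fun c => hb c 3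
  simp only [hr, Fin.sum_univ_four]
  simp [h0, h1, h2, h3]
  ring

theorem trace_realMulVec (E : Matrix (Fin n) (Fin n) ℍ[ℝ]) :
    LinearMap.trace ℝ _ (realMulVec E) = 4 * (Matrix.trace E).re := by
  rw [LinearMap.trace_eq_matrix_trace ℝ (Pi.basis fun _ : Fin n => quaternionBasis),
    Matrix.trace, Fintype.sum_sigma, Matrix.trace, re_sum, Finset.mul_sum]
  refine Finset.sum_congr rfl fun i _ => ?_
  rw [← trace_mulLeft]
  refine Finset.sum_congr rfl fun c _ => ?_
  simp only [Matrix.diag_apply, LinearMap.toMatrix_apply, Pi.basis_repr, Pi.basis_apply,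
    realMulVec, LinearMap.coe_mk, AddHom.coe_mk, Matrix.mulVec_single]
  rfl

/-- As a real-linear map, `E` is a projection onto its column space, which has real dimension
`4 * rank E`; its real trace is `4 * (trace E).re`. -/
theorem rank_eq_trace_of_isIdempotentElem {E : Matrix (Fin n) (Fin n) ℍ[ℝ]}
    (hE : IsIdempotentElem E) : (rank E : ℝ) = (Matrix.trace E).re := by
  set p := (Submodule.span ℍ[ℝ]ᵐᵒᵖ (Set.range E.col)).restrictScalars ℝ with hp
  have hproj : LinearMap.IsProj p (realMulVec E) := by
    constructor
    · intro x
      rw [hp, Submodule.restrictScalars_mem]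
      refine (Submodule.mem_span_range_iff_exists_fun _).2 ⟨fun l => MulOpposite.op (x l), ?_⟩
      ext1 i
      simp [realMulVec, Matrix.mulVec, dotProduct]
    · intro x hx
      rw [hp, Submodule.restrictScalars_mem] at hx
      obtain ⟨c, rfl⟩ := (Submodule.mem_span_range_iff_exists_fun _).1 hx
      have h1 : ∀ l, realMulVec E (c l • E.col l) = c l • E.col l := by
        intro l
        change E.mulVec (c l • E.col l) = _
        rw [Matrix.mulVec_smul]
        congr 1
        ext1 i
        exact congrFun (congrFun hE i) l
      rw [map_sum, Finset.sum_congr rfl fun l _ => h1 l]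
  have h1 := hproj.trace
  rw [trace_realMulVec] at h1
  have h2 : Module.finrank ℝ p = 4 * rank E := by
    have h3 := Module.finrank_mul_finrank ℝ ℍ[ℝ]ᵐᵒᵖ
      (Submodule.span ℍ[ℝ]ᵐᵒᵖ (Set.range E.col))
    have h4 : Module.finrank ℝ ℍ[ℝ]ᵐᵒᵖ = 4 := by
      rw [← (MulOpposite.opLinearEquiv ℝ (M := ℍ[ℝ])).finrank_eq, Quaternion.finrank_eq_four]
    rw [h4] at h3
    exact h3.symm
  rw [h2] at h1
  push_cast at h1
  linarith

end Idempotent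

/-! ### The principal minor sums at the rank -/

section Rank

variable {n : ℕ} {M : Matrix (Fin n) (Fin n) ℍ[ℝ]}

theorem eq_zero_of_conjTranspose_mul_self {Y : Matrix (Fin n) (Fin n) ℍ[ℝ]}
    (h : Y.conjTranspose * Y = 0) : Y = 0 := by
  ext1 i j
  have h1 := congrFun (congrFun h j) j
  rw [Matrix.mul_apply] at h1
  have h2 : ∑ l, Quaternion.normSq (Y l j) = 0 := by
    have h3 : ∑ l, ((Quaternion.normSq (Y l j) : ℝ) : ℍ[ℝ]) = 0 := by
      rw [← Matrix.zero_apply j j, ← h1]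
      exact Finset.sum_congr rfl fun l _ => (Quaternion.star_mul_self (Y l j)).symm
    have h4 := congrArg (fun x : ℍ[ℝ] => x.re) h3
    rw [re_sum] at h4
    simpa using h4
  have := (Finset.sum_eq_zero_iff_of_nonneg fun l _ => Quaternion.normSq_nonneg).1 h2 i
    (Finset.mem_univ i)
  rw [Matrix.zero_apply]
  exact Quaternion.normSq_eq_zero.1 this

theorem mul_eq_zero_of_pow_mul_eq_zero (hM : M.IsHermitian) (m : ℕ)
    {Y : Matrix (Fin n) (Fin n) ℍ[ℝ]} (h : M ^ m * Y = 0) : M * Y = 0 := by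
  have key : ∀ Z : Matrix (Fin n) (Fin n) ℍ[ℝ], M * (M * Z) = 0 → M * Z = 0 := by
    intro Z hZ
    apply eq_zero_of_conjTranspose_mul_self
    rw [Matrix.conjTranspose_mul, hM.eq, mul_assoc, hZ, mul_zero]
  induction m generalizing Y with
  | zero => rw [pow_zero, one_mul] at h; rw [h, mul_zero]
  | succ m ih =>
    rw [pow_succ, mul_assoc] at h
    exact key _ (ih h)

/-- The last nonvanishing principal minor sum of a Hermitian matrix is the one whose order is the
rank. With `c = minorSum s M` the last one, the recursion and `adjSum (n + 1) M = 0` give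
`M * adjSum (s + 1) M = 0`, so `c⁻¹ • (M * adjSum s M)` is idempotent. It has the column space
of `M`, and its trace is `s`. -/
theorem minorSum_rank_ne_zero_and_sq_mul_adjSum (hM : M.IsHermitian) :
    minorSum (rank M) M ≠ 0 ∧ M * (M * adjSum (rank M) M) = minorSum (rank M) M • M := by
  obtain ⟨s, hsn, hs, hmax⟩ : ∃ s ≤ n, minorSum s M ≠ 0 ∧
      ∀ k, s < k → k ≤ n → minorSum k M = 0 := by
    refine ⟨Nat.findGreatest (fun k => minorSum k M ≠ 0) n, Nat.findGreatest_le n,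
      Nat.findGreatest_spec (P := fun k => minorSum k M ≠ 0) (Nat.zero_le n)
        (by rw [minorSum_zero]; exact one_ne_zero), fun k h1 h2 => ?_⟩
    by_contra h
    exact h1.not_ge (Nat.le_findGreatest h2 h)
  have hpow : ∀ t, s + t ≤ n → adjSum (s + t + 1) M = (-1) ^ t * (M ^ t * adjSum (s + 1) M) := by
    intro t
    induction t with
    | zero => simp
    | succ t ih =>
      intro ht
      rw [adjSum_succ hM, hmax _ (by omega) ht, zero_smul, zero_sub, ← add_assoc, ih (by omega)]
      rcases neg_one_pow_eq_or (Matrix (Fin n) (Fin n) ℍ[ℝ]) t with h | h <;>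
        rw [pow_succ, pow_succ' M, h] <;> simp [mul_assoc]
  have hzero : M * adjSum (s + 1) M = 0 := by
    apply mul_eq_zero_of_pow_mul_eq_zero hM (n - s)
    have h := hpow (n - s) (by omega)
    rw [Nat.add_sub_cancel' hsn, adjSum_of_lt (Nat.lt_succ_self n)] at h
    rcases neg_one_pow_eq_or (Matrix (Fin n) (Fin n) ℍ[ℝ]) (n - s) with h' | h' <;>
      rw [h'] at h <;> simpa using h.symm
  set c := minorSum s M with hc
  have hsq : M * (M * adjSum s M) = c • M := by
    rw [adjSum_succ hM, mul_sub, sub_eq_zero] at hzero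
    rw [← hzero, mul_smul_comm, mul_one]
  have hcomm := (commute_adjSum hM s).eq
  set E := c⁻¹ • (M * adjSum s M) with hE
  have hEM : E * M = M := by
    rw [hE, smul_mul_assoc, mul_assoc, ← hcomm, hsq, smul_smul,
      inv_mul_cancel₀ hs, one_smul]
  have hE' : E = M * (c⁻¹ • adjSum s M) := by rw [hE, mul_smul_comm]
  have hidem : IsIdempotentElem E := by
    change E * E = E
    conv_lhs => rw [hE', ← mul_assoc, ← hE', hEM]
    rw [← hE']
  have hrank : rank E = rank M := by
    have hspan : Submodule.span ℍ[ℝ]ᵐᵒᵖ (Set.range E.col) =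
        Submodule.span ℍ[ℝ]ᵐᵒᵖ (Set.range M.col) := by
      apply le_antisymm
      · rw [hE']; exact span_col_mul_le _ _
      · conv_lhs => rw [← hEM]
        exact span_col_mul_le _ _
    unfold rank
    rw [hspan]
  have hrs : rank M = s := by
    have h1 := rank_eq_trace_of_isIdempotentElem hidem
    have h2 := trace_adjSum_succ (M := M) hsn
    rw [adjSum_succ hM, Matrix.trace_sub, Matrix.trace_smul, Matrix.trace_one, Fintype.card_fin,
      Quaternion.re_sub, Quaternion.re_smul, Quaternion.re_natCast, smul_eq_mul, ← hc] at h2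
    rw [hrank, hE, Matrix.trace_smul, Quaternion.re_smul, smul_eq_mul] at h1
    have h3 : (Matrix.trace (M * adjSum s M)).re = s * c := by linarith
    rw [h3, mul_comm (s : ℝ), inv_mul_cancel_left₀ hs] at h1
    exact_mod_cast h1
  rw [hrs]
  exact ⟨hs, hsq⟩

end Rank

/-! ### The Drazin inverse -/

section Drazin

variable {n : ℕ} {A : Matrix (Fin n) (Fin n) ℍ[ℝ]}

theorem drazinInverse_eq_pow_mul (A : Matrix (Fin n) (Fin n) ℍ[ℝ]) (m : ℕ) :
    drazinInverse A = A ^ m * drazinInverse A ^ (m + 1) := by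
  have hX := isDrazinInverse_drazinInverse A
  set X := drazinInverse A
  induction m with
  | zero => simp
  | succ m ih =>
    calc X = A ^ m * X ^ (m + 1) := ih
      _ = A ^ m * (X * A * X * X ^ m) := by rw [hX.mul_mul_self, ← pow_succ']
      _ = A ^ (m + 1) * X ^ (m + 1 + 1) := by
        rw [← hX.comm, pow_succ A, pow_succ' X (m + 1), pow_succ' X m]; simp only [mul_assoc]

variable (hA : A.IsHermitian)
include hA

theorem adjSum_mul_pow_index :
    adjSum (rank (A ^ (index A + 1))) (A ^ (index A + 1)) * A ^ index A =
      minorSum (rank (A ^ (index A + 1))) (A ^ (index A + 1)) • drazinInverse A := by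
  have hX := isDrazinInverse_drazinInverse A
  have hM : (A ^ (index A + 1)).IsHermitian := hA.pow _
  have h := (minorSum_rank_ne_zero_and_sq_mul_adjSum hM).2
  have hc := (commute_adjSum hM (rank (A ^ (index A + 1)))).eq
  have hY := drazinInverse_eq_pow_mul A (index A + 1)
  set M := A ^ (index A + 1)
  set P := adjSum (rank M) M
  set Y := drazinInverse A ^ (index A + 1 + 1)
  rw [← hX.pow_succ_mul, hY]
  change P * (M * (M * Y)) = _ • (M * Y)
  rw [← smul_mul_assoc, ← h, hc]
  simp only [← mul_assoc]
  rw [hc]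

theorem pow_index_mul_adjSum :
    A ^ index A * adjSum (rank (A ^ (index A + 1))) (A ^ (index A + 1)) =
      minorSum (rank (A ^ (index A + 1))) (A ^ (index A + 1)) • drazinInverse A := by
  have hX := isDrazinInverse_drazinInverse A
  have hM : (A ^ (index A + 1)).IsHermitian := hA.pow _
  have hc := (commute_adjSum hM (rank (A ^ (index A + 1)))).eq
  have h := (minorSum_rank_ne_zero_and_sq_mul_adjSum hM).2
  have hXA : Commute (drazinInverse A) A := hX.comm.symm
  have hpow : A ^ index A = drazinInverse A * A ^ (index A + 1) := by
    rw [(hXA.pow_right _).eq, hX.pow_succ_mul]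
  have hY : drazinInverse A = drazinInverse A ^ (index A + 1 + 1) * A ^ (index A + 1) := by
    rw [(hXA.pow_pow _ _).eq, ← drazinInverse_eq_pow_mul]
  set M := A ^ (index A + 1)
  set P := adjSum (rank M) M
  rw [hpow, mul_assoc]
  conv_lhs => rw [hY]
  rw [mul_assoc, h, mul_smul_comm, ← hY]

end Drazin

end QuatDrazin

theorem theorem4p3 (n m : ℕ) (A : Matrix (Fin n) (Fin n) ℍ[ℝ]) (B : Matrix (Fin m) (Fin m) ℍ[ℝ])
    (D : Matrix (Fin n) (Fin m) ℍ[ℝ]) (hA : A.IsHermitian) (hB : B.IsHermitian)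
    (k₁ k₂ r₁ r₂ : ℕ) (hk₁ : QuatDrazin.index A = k₁) (hk₂ : QuatDrazin.index B = k₂)
    (hr₁ : QuatDrazin.rank (A ^ (k₁ + 1)) = r₁) (hr₁' : QuatDrazin.rank (A ^ k₁) = r₁)
    (hr₂ : QuatDrazin.rank (B ^ (k₂ + 1)) = r₂) (hr₂' : QuatDrazin.rank (B ^ k₂) = r₂)
    (Dt X : Matrix (Fin n) (Fin m) ℍ[ℝ]) (hDt : Dt = A ^ k₁ * D * B ^ k₂)
    (hX : X = QuatDrazin.drazinInverse A * D * QuatDrazin.drazinInverse B)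
    (dB dA : Matrix (Fin n) (Fin m) ℍ[ℝ])
    (hdB : ∀ l j, dB l j = QuatDrazin.rdetSum r₂ (B ^ (k₂ + 1)) j (fun t => Dt l t))
    (hdA : ∀ i t, dA i t = QuatDrazin.cdetSum r₁ (A ^ (k₁ + 1)) i (fun l => Dt l t)) :
    -- The denominators are nonzero real numbers, so that the quotients make sense.
    (∃ δ : ℝ, δ ≠ 0 ∧ QuatDrazin.principalMinorSum r₁ (A ^ (k₁ + 1)) = (δ : ℍ[ℝ])) ∧
    (∃ δ : ℝ, δ ≠ 0 ∧ QuatDrazin.principalMinorSum r₂ (B ^ (k₂ + 1)) = (δ : ℍ[ℝ])) ∧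
    ∀ i j,
      X i j = QuatDrazin.cdetSum r₁ (A ^ (k₁ + 1)) i (fun l => dB l j) /
        (QuatDrazin.principalMinorSum r₁ (A ^ (k₁ + 1)) *
          QuatDrazin.principalMinorSum r₂ (B ^ (k₂ + 1))) ∧
      X i j = QuatDrazin.rdetSum r₂ (B ^ (k₂ + 1)) j (fun t => dA i t) /
        (QuatDrazin.principalMinorSum r₁ (A ^ (k₁ + 1)) *
          QuatDrazin.principalMinorSum r₂ (B ^ (k₂ + 1))) := by
  subst hk₁ hk₂ hr₁ hr₂
  have hMA : (A ^ (QuatDrazin.index A + 1)).IsHermitian := hA.pow _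
  have hMB : (B ^ (QuatDrazin.index B + 1)).IsHermitian := hB.pow _
  have hPA := QuatDrazin.adjSum_mul_pow_index hA
  have hQB := QuatDrazin.pow_index_mul_adjSum hB
  have hc := (QuatDrazin.minorSum_rank_ne_zero_and_sq_mul_adjSum hMA).1
  have hd := (QuatDrazin.minorSum_rank_ne_zero_and_sq_mul_adjSum hMB).1
  rw [QuatDrazin.principalMinorSum_eq_coe hMA, QuatDrazin.principalMinorSum_eq_coe hMB]
  set M := A ^ (QuatDrazin.index A + 1)
  set N := B ^ (QuatDrazin.index B + 1)
  set r := QuatDrazin.rank M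
  set s := QuatDrazin.rank N
  set P := QuatDrazin.adjSum r M with hP
  set Q := QuatDrazin.adjSum s N with hQ
  set c := QuatDrazin.minorSum r M
  set d := QuatDrazin.minorSum s N
  refine ⟨⟨c, hc, rfl⟩, ⟨d, hd, rfl⟩, ?_⟩
  have hXcd : P * Dt * Q = (c * d) • X := by
    calc P * Dt * Q = P * A ^ QuatDrazin.index A * D * (B ^ QuatDrazin.index B * Q) := by
          rw [hDt]; simp only [Matrix.mul_assoc]
      _ = (c * d) • X := by
          rw [hPA, hQB, hX, Matrix.smul_mul, Matrix.smul_mul, Matrix.mul_smul, smul_smul]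
  have hdB' : dB = Dt * Q := by
    ext1 l j
    rw [hdB, QuatDrazin.rdetSum_eq, Matrix.mul_apply]
  have hdA' : dA = P * Dt := by
    ext1 i t
    rw [hdA, QuatDrazin.cdetSum_eq hMA, Matrix.mul_apply]
  have hdiv : ∀ i j, X i j = (P * Dt * Q) i j / ((c : ℍ[ℝ]) * (d : ℍ[ℝ])) := by
    intro i j
    have hcd : ((c * d : ℝ) : ℍ[ℝ]) ≠ 0 := fun h =>
      mul_ne_zero hc hd (Quaternion.coe_injective (h.trans Quaternion.coe_zero.symm))
    rw [← Quaternion.coe_mul, eq_div_iff hcd, hXcd, Matrix.smul_apply,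
      ← Quaternion.coe_mul_eq_smul, Quaternion.coe_commutes]
  intro i j
  constructor
  · rw [hdiv, QuatDrazin.cdetSum_eq hMA, hdB', Matrix.mul_assoc, Matrix.mul_apply]
  · rw [hdiv, QuatDrazin.rdetSum_eq, hdA', Matrix.mul_apply]
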